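/- **Setting.** Let $\mathbf X_1,\dots,\mathbf X_n$ be i.i.d. random vectors in $\mathbb R^d$ with law $\mu$. Let $\mathcal T$ be a set of maps $\mathbb R^d\to\mathbb R^d$ with a $\sigma$-algebra for which $(\phi,x)\mapsto\phi x$ is jointly measurable, and let $\phi_{ij}$ ($i\le n$, $j\le k$) be i.i.d. random elements of $\mathcal T$ with law $\nu$, independent of $(\mathbf X_i)_i$; here $n,k\ge 1$. Assume $\mathbb E\|\phi_{11}\mathbf X_1\|^2<\infty$. Put $\Phi_i\mathbf X_i:=(\phi_{i1}\mathbf X_i,\dots,\phi_{ik}\mathbf X_i)\in\mathbb R^{kd}$ and $\Phi\mathcal X:=(\Phi_1\mathbf X_1,\dots,\Phi_n\mathbf X_n)\in\mathbb R^{nkd}$. Let $\Sigma_{11}:=\mathrm{Var}[\phi_{11}\mathbf X_1]$ and $\Sigma_{12}:=\mathrm{Cov}[\phi_{11}\mathbf X_1,\phi_{12}\mathbf X_1]$ (for $k=1$, $\phi_{12}$ denotes a copy of $\phi_{11}$ independent of $(\phi_{11},\mathbf X_1)$). Let $\mathcal F_3(\mathbb R^a,\mathbb R^b)$ be the class of three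 times differentiable functions $\mathbb R^a\to\mathbb R^b$ (the third derivative need not be continuous). For vectors, matrices and tensors, $\|\cdot\|$ is the square root of the sum of the squares of all entries. For $h:\mathbb R^q\to\mathbb R$ put $\gamma^3(h):=\sup_{v\in\mathbb R^q}\|\partial^3h(v)\|$ and $\eta^r(h):=\|\partial^rh(0)\|$. View $f:\mathbb R^{nkd}\to\mathbb R^q$ as a function of $n$ arguments in $\mathbb R^{kd}$ and let $D_i^rf$ be its $r$-th derivative in the $i$-th argument ($D_i^0f=f$). For random vectors $\mathbf Z_1,\dots,\mathbf Z_n$ in $\mathbb R^{kd}$ put $\mathbf W_i(\mathbf w):=(\Phi_1\mathbf X_1,\dots,\Phi_{i-1}\mathbf X_{i-1},\mathbf w,\mathbf Z_{i+1},\dots,\mathbf Z_n)$ and $$\alpha^r_m:=\max_{i\le n}\max\Bigl\{\bigl\|\sup_{\mathbf w\in[\mathbf 0,\Phi_i\mathbf X_i]}\|D_i^rf(\mathbf W_i(\mathbf w))\|\bigr\|_{L_m},\ \bigl\|\sup_{\mathbf w\in[\mathbf 0,\mathbf Z_i]}\|D_i^rf(\mathbf W_i(\mathbf w))\|\bigr\|_{L_m}\Bigr\},$$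 where $[\mathbf 0,\mathbf x]$ is the segment from $\mathbf 0$ to $\mathbf x$ and $\|U\|_{L_m}=\mathbb E[|U|^m]^{1/m}$. Define $$\lambda_1:=\gamma^3(h)\bigl(\alpha^0_3(\alpha^1_3)^2+(\alpha^0_3)^2\alpha^2_3\bigr)+\eta^2(h)\bigl((\alpha^1_2)^2+\alpha^0_2\alpha^2_2\bigr)+\eta^1(h)\alpha^2_1,$$ $$\lambda_2:=\gamma^3(h)\bigl((\alpha^1_6)^3+3\alpha^0_6\alpha^1_6\alpha^2_6+(\alpha^0_6)^2\alpha^3_6\bigr)+\eta^2(h)\bigl(3\alpha^1_4\alpha^2_4+\alpha^0_4\alpha^3_4\bigr)+\eta^1(h)\alpha^3_2,$$ $$c_1:=\tfrac12\bigl\|\mathbb E\,\mathrm{Var}(\phi_{11}\mathbf X_1\mid\mathbf X_1)\bigr\|,\qquad c_2:=\tfrac16\sqrt{\mathbb E\|\phi_{11}\mathbf X_1\|^6},\qquad c_3:=\tfrac16\sqrt{\mathbb E\Bigl[\tfrac{(|Z_{111}|^2+\dots+|Z_{1kd}|^2)^3}{k^3}\Bigr]},$$ where $\mathbf Z_i=(Z_{ijl})_{j\le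 k,\,l\le d}$. All of these quantities take values in $[0,\infty]$, with $0\cdot\infty=0$. **Theorem (Main result).** For every $\delta\in[0,1]$ there are, after enlarging the probability space if necessary, i.i.d. (possibly degenerate) Gaussian vectors $\mathbf Z_1,\dots,\mathbf Z_n$ in $\mathbb R^{kd}$, jointly independent of the data and the transformations, with $$\mathbb E\mathbf Z_i=\mathbf 1_{k\times1}\otimes\mathbb E[\phi_{11}\mathbf X_1],\qquad \mathrm{Var}[\mathbf Z_i]=\mathbf I_k\otimes\bigl((1-\delta)\Sigma_{11}+\delta\Sigma_{12}\bigr)+(\mathbf 1_{k\times k}-\mathbf I_k)\otimes\Sigma_{12},$$ such that, for all $q\in\mathbb N$, $f\in\mathcal F_3(\mathbb R^{nkd},\mathbb R^q)$ and $h\in\mathcal F_3(\mathbb R^q,\mathbb R)$ for which $h(f(\Phi\mathcal X))$ and $h(f(\mathbf Z_1,\dots,\mathbf Z_n))$ are integrable, $$\bigl|\mathbb E h(f(\Phi\mathcal X))-\mathbb E h(f(\mathbf Z_1,\dots,\mathbf Z_n))\bigr|\le nk^{1/2}\lambda_1\,\delta\,c_1+nk^{3/2}\lambda_2\,(c_2+c_3).$$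 Moreover $c_3=O(1)$: there is a finite constant $C$ that depends only on $\mu$, $\nu$ and $\mathcal T$ (not on $n$, $k$ or $\delta$) such that $c_3\le C$. -/

import Mathlib

open MeasureTheory ProbabilityTheory
open scoped ENNReal NNReal Kronecker

universe u v

namespace Augmentation

noncomputable section

/-- `ℝᵈ` with the Euclidean norm. -/
abbrev Vec (d : ℕ) : Type := EuclideanSpace ℝ (Fin d)

/-- One block `ℝ^{kd}`, with coordinates indexed by pairs `(j, l)`, `j ≤ k`, `l ≤ d`.
The space `ℝ^{nkd} = (ℝ^{kd})^n` is `Fin n → Blk k d`. -/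
abbrev Blk (k d : ℕ) : Type := EuclideanSpace ℝ (Fin k × Fin d)

/-! ### Differentiability classes, derivatives and norms -/

/-- The class `F_r(E, F)` of `r` times differentiable functions. The `r`-th derivative exists
everywhere and is not required to be continuous. -/
def IsTimesDiff {E F : Type*} [NormedAddCommGroup E] [NormedSpace ℝ E]
    [NormedAddCommGroup F] [NormedSpace ℝ F] (r : ℕ) (f : E → F) : Prop :=
  ∀ s < r, Differentiable ℝ (iteratedFDeriv ℝ s f)

/-- The flattened Euclidean norm of a tensor: the square root of the sum of the squares of all its
entries (for values in `ℝ^q`, the squared norm of the value is the sum over the `q` entries). -/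
def tensorNorm {ι F : Type*} [Fintype ι] [DecidableEq ι] [NormedAddCommGroup F] [NormedSpace ℝ F]
    {r : ℕ} (T : ContinuousMultilinearMap ℝ (fun _ : Fin r => EuclideanSpace ℝ ι) F) : ℝ :=
  Real.sqrt (∑ c : Fin r → ι, ‖T (fun s => EuclideanSpace.single (c s) (1 : ℝ))‖ ^ 2)

/-- The flattened Euclidean norm of a matrix. -/
def matrixNorm {d : ℕ} (A : Matrix (Fin d) (Fin d) ℝ) : ℝ :=
  Real.sqrt (∑ a, ∑ b, A a b ^ 2)

/-- `D_i^r f(v_1, …, v_n)`, the `r`-th derivative in the `i`-th block. -/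
def blockDeriv {n k d q : ℕ} (r : ℕ) (f : (Fin n → Blk k d) → Vec q) (i : Fin n)
    (v : Fin n → Blk k d) :
    ContinuousMultilinearMap ℝ (fun _ : Fin r => Blk k d) (Vec q) :=
  iteratedFDeriv ℝ r (fun u : Blk k d => f (Function.update v i u)) (v i)

/-- `γ³(h) = sup_v ‖∂³h(v)‖`. -/
def gamma3 {q : ℕ} (h : Vec q → ℝ) : ℝ≥0∞ :=
  ⨆ v : Vec q, ENNReal.ofReal (tensorNorm (iteratedFDeriv ℝ 3 h v))

/-- `η^r(h) = ‖∂^r h(0)‖`. -/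
def eta {q : ℕ} (r : ℕ) (h : Vec q → ℝ) : ℝ≥0∞ :=
  ENNReal.ofReal (tensorNorm (iteratedFDeriv ℝ r h 0))

/-- `‖U‖_{L_m} = E[U^m]^{1/m}` for a nonnegative random variable `U`. -/
def normL {Ω : Type*} [MeasurableSpace Ω] (P : Measure Ω) (m : ℕ) (U : Ω → ℝ≥0∞) : ℝ≥0∞ :=
  (∫⁻ ω, U ω ^ m ∂P) ^ ((1 : ℝ) / m)

/-! ### Data, augmentation and moments -/

/-- The augmented data `ΦX = (Φ_1 X_1, …, Φ_n X_n)`, whose `i`-th block is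
`Φ_i X_i = (φ_{i1} X_i, …, φ_{ik} X_i)`. The map `ev t : ℝᵈ → ℝᵈ` is the transformation `t`. -/
def augmentedData {n k d : ℕ} {Ω 𝒯 : Type*} (ev : 𝒯 → Vec d → Vec d)
    (φ : Fin n → Fin k → Ω → 𝒯) (X : Fin n → Ω → Vec d) (ω : Ω) : Fin n → Blk k d :=
  fun i => WithLp.toLp 2 (fun p : Fin k × Fin d => ev (φ i p.1 ω) (X i ω) p.2)

/-- `X_1, …, X_n` are i.i.d. with law `μ`, the `nk` transformations `φ_{ij}` are i.i.d. with
law `ν`, and the transformations are independent of the `X_i`. -/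
structure IsSample {n k d : ℕ} {Ω 𝒯 : Type*} [MeasurableSpace Ω] [MeasurableSpace 𝒯]
    (P : Measure Ω) (μ : Measure (Vec d)) (ν : Measure 𝒯)
    (X : Fin n → Ω → Vec d) (φ : Fin n → Fin k → Ω → 𝒯) : Prop where
  measurable_X : ∀ i, Measurable (X i)
  measurable_φ : ∀ i j, Measurable (φ i j)
  law_X : ∀ i, P.map (X i) = μ
  law_φ : ∀ i j, P.map (φ i j) = ν
  indep_X : iIndepFun X P
  indep_φ : iIndepFun (fun p : Fin n × Fin k => φ p.1 p.2) P
  indep_X_φ : IndepFun (fun ω i => X i ω) (fun ω i j => φ i j ω) P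

/-- The covariance matrix `Cov(U, V)`. -/
def covMatrix {Ω ι : Type*} [MeasurableSpace Ω] (P : Measure Ω)
    (U V : Ω → EuclideanSpace ℝ ι) : Matrix ι ι ℝ :=
  Matrix.of fun a b => cov[fun ω => U ω a, fun ω => V ω b; P]

/-- `E Var(U | m)`: the expectation of the conditional covariance matrix of `U` given the
σ-algebra `m`. -/
def expCondVar {Ω : Type*} [MeasurableSpace Ω] {d : ℕ} (P : Measure Ω)
    (m : MeasurableSpace Ω) (U : Ω → Vec d) : Matrix (Fin d) (Fin d) ℝ :=
  Matrix.of fun a b => ∫ ω,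
    (P[fun ω' => (U ω' a - (P[fun ω'' => U ω'' a | m]) ω') *
      (U ω' b - (P[fun ω'' => U ω'' b | m]) ω') | m]) ω ∂P

/-! The moments below are those of `X ∼ μ` and `φ, ψ ∼ ν` independent, realised as the coordinates
of the product space `ℝᵈ × 𝒯 × 𝒯`. For a sample, `(X_1, φ_{11}, φ_{12})` has the same law as
`(X, φ, ψ)`; the independent copy `ψ` makes sense also if `k = 1`. -/

section Moments

variable {d : ℕ} {𝒯 : Type*} [MeasurableSpace 𝒯]

/-- The joint law of `(X, φ, ψ)`. -/
def tripleLaw (μ : Measure (Vec d)) (ν : Measure 𝒯) : Measure (Vec d × 𝒯 × 𝒯) :=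
  μ.prod (ν.prod ν)

/-- The random vector `φX`. -/
def phiX (ev : 𝒯 → Vec d → Vec d) (p : Vec d × 𝒯 × 𝒯) : Vec d := ev p.2.1 p.1

/-- The random vector `ψX`. -/
def psiX (ev : 𝒯 → Vec d → Vec d) (p : Vec d × 𝒯 × 𝒯) : Vec d := ev p.2.2 p.1

/-- `E[φ₁₁X₁]`. -/
def meanAug (ev : 𝒯 → Vec d → Vec d) (μ : Measure (Vec d)) (ν : Measure 𝒯) : Vec d :=
  ∫ p, phiX ev p ∂(tripleLaw μ ν)

/-- `Σ₁₁ = Var[φ₁₁X₁]`. -/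
def Sigma11 (ev : 𝒯 → Vec d → Vec d) (μ : Measure (Vec d)) (ν : Measure 𝒯) :
    Matrix (Fin d) (Fin d) ℝ :=
  covMatrix (tripleLaw μ ν) (phiX ev) (phiX ev)

/-- `Σ₁₂ = Cov[φ₁₁X₁, φ₁₂X₁]`. -/
def Sigma12 (ev : 𝒯 → Vec d → Vec d) (μ : Measure (Vec d)) (ν : Measure 𝒯) :
    Matrix (Fin d) (Fin d) ℝ :=
  covMatrix (tripleLaw μ ν) (phiX ev) (psiX ev)

/-- `c₁ = ½ ‖E Var(φ₁₁X₁ | X₁)‖`. -/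
def c1 (ev : 𝒯 → Vec d → Vec d) (μ : Measure (Vec d)) (ν : Measure 𝒯) : ℝ≥0∞ :=
  ENNReal.ofReal (1 / 2 * matrixNorm
    (expCondVar (tripleLaw μ ν)
      (MeasurableSpace.comap (Prod.fst : Vec d × 𝒯 × 𝒯 → Vec d) inferInstance) (phiX ev)))

/-- `c₂ = (1/6) √(E‖φ₁₁X₁‖⁶)`. -/
def c2 (ev : 𝒯 → Vec d → Vec d) (μ : Measure (Vec d)) (ν : Measure 𝒯) : ℝ≥0∞ :=
  ENNReal.ofReal (1 / 6) * (∫⁻ p, ‖phiX ev p‖ₑ ^ 6 ∂(tripleLaw μ ν)) ^ ((1 : ℝ) / 2)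

/-- The mean `1_{k×1} ⊗ E[φ₁₁X₁]` of the Gaussian vectors. -/
def surrogateMean (k : ℕ) (ev : 𝒯 → Vec d → Vec d) (μ : Measure (Vec d)) (ν : Measure 𝒯) :
    Blk k d :=
  WithLp.toLp 2 (fun p : Fin k × Fin d => meanAug ev μ ν p.2)

/-- The covariance `I_k ⊗ ((1-δ)Σ₁₁ + δΣ₁₂) + (1_{k×k} - I_k) ⊗ Σ₁₂` of the Gaussian vectors. -/
def surrogateCov (k : ℕ) (δ : ℝ) (ev : 𝒯 → Vec d → Vec d) (μ : Measure (Vec d))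
    (ν : Measure 𝒯) : Matrix (Fin k × Fin d) (Fin k × Fin d) ℝ :=
  (1 : Matrix (Fin k) (Fin k) ℝ) ⊗ₖ ((1 - δ) • Sigma11 ev μ ν + δ • Sigma12 ev μ ν) +
    ((Matrix.of fun _ _ => 1) - (1 : Matrix (Fin k) (Fin k) ℝ)) ⊗ₖ Sigma12 ev μ ν

end Moments

/-! ### Gaussian vectors -/

/-- `Z_1, …, Z_n` are i.i.d. Gaussian vectors in `ℝ^{kd}` (possibly degenerate) with mean `m` and
covariance matrix `V`. -/
structure IsIIDGaussian {n k d : ℕ} {Ω : Type*} [MeasurableSpace Ω] (P : Measure Ω)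
    (Z : Ω → Fin n → Blk k d) (m : Blk k d)
    (V : Matrix (Fin k × Fin d) (Fin k × Fin d) ℝ) : Prop where
  measurable : Measurable Z
  indep : iIndepFun (fun i ω => Z ω i) P
  identDistrib : ∀ i j, IdentDistrib (fun ω => Z ω i) (fun ω => Z ω j) P P
  gaussian : ∀ i, HasGaussianLaw (fun ω => Z ω i) P
  mean : ∀ i, ∫ ω, Z ω i ∂P = m
  cov : ∀ i, covMatrix P (fun ω => Z ω i) (fun ω => Z ω i) = V

/-- `c₃ = (1/6) √(E[(|Z_{111}|² + … + |Z_{1kd}|²)³ / k³])`, for `Z = Z_1`. -/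
def c3 {k d : ℕ} {Ω : Type*} [MeasurableSpace Ω] (P : Measure Ω) (Z : Ω → Blk k d) : ℝ≥0∞ :=
  ENNReal.ofReal (1 / 6) *
    (∫⁻ ω, ENNReal.ofReal ((∑ j, ∑ l, |Z ω (j, l)| ^ 2) ^ 3 / (k : ℝ) ^ 3) ∂P) ^ ((1 : ℝ) / 2)

/-! ### Noise stability -/

section Stability

variable {n k d q : ℕ}

/-- `W_i(w) = (y_1, …, y_{i-1}, w, z_{i+1}, …, z_n)`. -/
def hybrid (y z : Fin n → Blk k d) (i : Fin n) (w : Blk k d) : Fin n → Blk k d :=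
  fun j => if j < i then y j else if j = i then w else z j

/-- `sup_{w ∈ [0, x]} ‖D_i^r f(W_i(w))‖`. -/
def supDeriv (r : ℕ) (f : (Fin n → Blk k d) → Vec q) (y z : Fin n → Blk k d) (i : Fin n)
    (x : Blk k d) : ℝ≥0∞ :=
  ⨆ w ∈ segment ℝ 0 x, ENNReal.ofReal (tensorNorm (blockDeriv r f i (hybrid y z i w)))

variable {Ω : Type*} [MeasurableSpace Ω]

/-- The noise stability `α^r_m` of `f`, for augmented data `Y` and Gaussian vectors `Z`. -/
def alpha (P : Measure Ω) (Y Z : Ω → Fin n → Blk k d) (f : (Fin n → Blk k d) → Vec q)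
    (r m : ℕ) : ℝ≥0∞ :=
  ⨆ i : Fin n, max (normL P m fun ω => supDeriv r f (Y ω) (Z ω) i (Y ω i))
    (normL P m fun ω => supDeriv r f (Y ω) (Z ω) i (Z ω i))

/-- The linear combination `λ₁(n, k)`. -/
def lambda1 (P : Measure Ω) (Y Z : Ω → Fin n → Blk k d) (f : (Fin n → Blk k d) → Vec q)
    (h : Vec q → ℝ) : ℝ≥0∞ :=
  let α := alpha P Y Z f
  gamma3 h * (α 0 3 * α 1 3 ^ 2 + α 0 3 ^ 2 * α 2 3)
    + eta 2 h * (α 1 2 ^ 2 + α 0 2 * α 2 2)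
    + eta 1 h * α 2 1

/-- The linear combination `λ₂(n, k)`. -/
def lambda2 (P : Measure Ω) (Y Z : Ω → Fin n → Blk k d) (f : (Fin n → Blk k d) → Vec q)
    (h : Vec q → ℝ) : ℝ≥0∞ :=
  let α := alpha P Y Z f
  gamma3 h * (α 1 6 ^ 3 + 3 * α 0 6 * α 1 6 * α 2 6 + α 0 6 ^ 2 * α 3 6)
    + eta 2 h * (3 * α 1 4 * α 2 4 + α 0 4 * α 3 4)
    + eta 1 h * α 3 2

end Stability

end

end Augmentation

open Augmentation

namespace Augmentation

/-! ### Sums of predictable multiples of independent centred increments -/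

section Predictable

variable {E F W : Type*} [NormedAddCommGroup W] [NormedSpace ℝ W]

/-- The coefficient `a i u v` depends only on `u j` for `j < i` and `v j` for `j > i`. -/
def IsHybridPredictable {n : ℕ} (a : Fin n → (Fin n → E) → (Fin n → F) → W →ₗ[ℝ] ℝ) : Prop :=
  ∀ i u u' v v', (∀ j < i, u j = u' j) → (∀ j, i < j → v j = v' j) → a i u v = a i u' v'

theorem IsHybridPredictable.add {n : ℕ} {a b : Fin n → (Fin n → E) → (Fin n → F) → W →ₗ[ℝ] ℝ}
    (ha : IsHybridPredictable a) (hb : IsHybridPredictable b) :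
    IsHybridPredictable fun i u v => a i u v + b i u v :=
  fun i u u' v v' hu hv => congrArg₂ (· + ·) (ha i u u' v v' hu hv) (hb i u u' v v' hu hv)

theorem IsHybridPredictable.sub {n : ℕ} {a b : Fin n → (Fin n → E) → (Fin n → F) → W →ₗ[ℝ] ℝ}
    (ha : IsHybridPredictable a) (hb : IsHybridPredictable b) :
    IsHybridPredictable fun i u v => a i u v - b i u v :=
  fun i u u' v v' hu hv => congrArg₂ (· - ·) (ha i u u' v v' hu hv) (hb i u u' v v' hu hv)

theorem IsHybridPredictable.const_smul {n : ℕ}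
    {a : Fin n → (Fin n → E) → (Fin n → F) → W →ₗ[ℝ] ℝ} (ha : IsHybridPredictable a) (r : ℝ) :
    IsHybridPredictable fun i u v => r • a i u v :=
  fun i u u' v v' hu hv => congrArg (r • ·) (ha i u u' v v' hu hv)

/-- A sum of increments with hybrid-predictable coefficients. -/
def hybridSum {n : ℕ} (ζ : E → W) (ξ : F → W)
    (a : Fin n → (Fin n → E) → (Fin n → F) → W →ₗ[ℝ] ℝ) (p : (Fin n → E) × (Fin n → F)) : ℝ :=
  ∑ i, a i p.1 p.2 (ζ (p.1 i) - ξ (p.2 i))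

variable [MeasurableSpace E] [MeasurableSpace F]

/-- The reindexing `((u₀, (u, v)), v₀) ↦ ((u₀, u), (v₀, v))` which peels off the first coordinates. -/
def consPair (n : ℕ) (p : (E × (Fin n → E) × (Fin n → F)) × F) :
    (Fin (n + 1) → E) × (Fin (n + 1) → F) :=
  (Fin.cons p.1.1 p.1.2.1, Fin.cons p.2 p.1.2.2)

theorem measurePreserving_finCons {n : ℕ} (μ : Measure E) [SigmaFinite μ] :
    MeasurePreserving (fun p : E × (Fin n → E) => (Fin.cons p.1 p.2 : Fin (n + 1) → E))
      (μ.prod (Measure.pi fun _ => μ)) (Measure.pi fun _ => μ) := by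
  have h := (measurePreserving_piFinSuccAbove (fun _ : Fin (n + 1) => μ) 0).symm
  convert h using 1
  ext p i
  simp [MeasurableEquiv.piFinSuccAbove, Fin.insertNthEquiv]

/-- The coordinate `v₀` is placed last so that Fubini integrates it out first: only the
coefficient-free part of the zeroth increment involves it. -/
theorem measurePreserving_consPair (n : ℕ) (μ : Measure E) [SigmaFinite μ] (ν : Measure F)
    [SigmaFinite ν] :
    MeasurePreserving (consPair (E := E) (F := F) n)
      ((μ.prod ((Measure.pi fun _ => μ).prod (Measure.pi fun _ => ν))).prod ν)
      ((Measure.pi fun _ => μ).prod (Measure.pi fun _ => ν)) := by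
  have h1 := (measurePreserving_finCons (n := n) μ).prod (measurePreserving_finCons (n := n) ν)
  have h2 : MeasurePreserving
      (fun p : (E × (Fin n → E) × (Fin n → F)) × F => ((p.1.1, p.1.2.1), (p.1.2.2, p.2)))
      ((μ.prod ((Measure.pi fun _ => μ).prod (Measure.pi fun _ => ν))).prod ν)
      ((μ.prod (Measure.pi fun _ => μ)).prod ((Measure.pi fun _ => ν).prod ν)) := by
    have h3 := ((measurePreserving_prodAssoc μ (Measure.pi fun _ : Fin n => μ)
      (Measure.pi fun _ : Fin n => ν)).symm).prod (MeasurePreserving.id ν)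
    exact (measurePreserving_prodAssoc (μ.prod (Measure.pi fun _ : Fin n => μ))
      (Measure.pi fun _ : Fin n => ν) ν).comp h3
  have h4 : MeasurePreserving (Prod.swap (α := Fin n → F) (β := F))
    ((Measure.pi fun _ => ν).prod ν) (ν.prod (Measure.pi fun _ => ν)) :=
    Measure.measurePreserving_swap
  exact h1.comp (((MeasurePreserving.id _).prod h4).comp h2)

variable [FiniteDimensional ℝ W]

/-- A linear functional on a subspace extends to all of `W`. Finite dimension makes the extension
continuous, so it commutes with the integral. -/
theorem integral_linearMap_comp_of_submodule {μ : Measure E} [IsProbabilityMeasure μ] {ζ : E → W}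
    (hζ : Integrable ζ μ) (hζ0 : ∫ x, ζ x ∂μ = 0) (S : Submodule ℝ W) (T : S →ₗ[ℝ] ℝ)
    (g : E → ℝ) (hg : ∀ᵐ x ∂μ, ∃ h : ζ x ∈ S, g x = T ⟨ζ x, h⟩) : ∫ x, g x ∂μ = 0 := by
  obtain ⟨T', hT'⟩ := T.exists_extend
  have h1 : g =ᵐ[μ] fun x => T'.toContinuousLinearMap (ζ x) := by
    filter_upwards [hg] with x ⟨h, hx⟩
    rw [hx, ← hT']; rfl
  rw [integral_congr_ae h1, ContinuousLinearMap.integral_comp_comm _ hζ, hζ0, map_zero]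

/-- A sum of centred increments with hybrid-predictable coefficients has mean zero as soon as it is
integrable; the coefficients and the single terms need not be integrable. -/
theorem integral_hybridSum_eq_zero {μ : Measure E} [IsProbabilityMeasure μ] {ν : Measure F}
    [IsProbabilityMeasure ν] {ζ : E → W} {ξ : F → W} (hζ : Integrable ζ μ) (hξ : Integrable ξ ν)
    (hζ0 : ∫ x, ζ x ∂μ = 0) (hξ0 : ∫ x, ξ x ∂ν = 0) :
    ∀ {n : ℕ} (a : Fin n → (Fin n → E) → (Fin n → F) → W →ₗ[ℝ] ℝ), IsHybridPredictable a →
      Integrable (hybridSum ζ ξ a) ((Measure.pi fun _ => μ).prod (Measure.pi fun _ => ν)) →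
      ∫ p, hybridSum ζ ξ a p ∂((Measure.pi fun _ => μ).prod (Measure.pi fun _ => ν)) = 0 := by
  have hne : Nonempty E := by
    by_contra h
    rw [not_nonempty_iff] at h
    exact IsProbabilityMeasure.ne_zero μ (Measure.eq_zero_of_isEmpty μ)
  have hnf : Nonempty F := by
    by_contra h
    rw [not_nonempty_iff] at h
    exact IsProbabilityMeasure.ne_zero ν (Measure.eq_zero_of_isEmpty ν)
  obtain ⟨e₀⟩ := hne
  obtain ⟨f₀⟩ := hnf
  intro n
  induction n with
  | zero => intro a _ _; simp [hybridSum]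
  | succ n ih =>
    intro a ha hint
    set Q := (Measure.pi fun _ : Fin n => μ).prod (Measure.pi fun _ : Fin n => ν) with hQ
    have hmp := measurePreserving_consPair (E := E) (F := F) n μ ν
    -- The points `e₀`, `f₀` fill coordinates on which predictable coefficients do not depend: `a 0`
    -- ignores all of `u` and also `v₀`, and the later coefficients ignore `v₀`.
    let b : (Fin n → F) → W →ₗ[ℝ] ℝ := fun v => a 0 (fun _ => e₀) (Fin.cons f₀ v)
    let a' : E → Fin n → (Fin n → E) → (Fin n → F) → W →ₗ[ℝ] ℝ :=
      fun x i u v => a i.succ (Fin.cons x u) (Fin.cons f₀ v)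
    have ha' : ∀ x, IsHybridPredictable (a' x) := by
      intro x i u u' v v' hu hv
      apply ha
      · intro j hj
        revert hj
        refine Fin.cases (fun _ => rfl) (fun j hj => ?_) j
        simpa using hu j (by simpa using hj)
      · intro j hj
        revert hj
        refine Fin.cases (fun _ => rfl) (fun j hj => ?_) j
        simpa using hv j (by simpa using hj)
    have hsplit : ∀ x u v y, hybridSum ζ ξ a (consPair n ((x, u, v), y)) =
        b v (ζ x) + hybridSum ζ ξ (a' x) (u, v) - b v (ξ y) := by
      intro x u v y
      have h0 : a 0 (Fin.cons x u) (Fin.cons y v) = b v := by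
        apply ha
        · intro j hj; exact absurd hj (by simp)
        · intro j hj
          obtain ⟨j, rfl⟩ := Fin.exists_succ_eq.2 hj.ne'
          simp
      have h1 : ∀ i : Fin n, a i.succ (Fin.cons x u) (Fin.cons y v) = a' x i u v := by
        intro i
        apply ha
        · intro j hj; rfl
        · intro j hj
          obtain ⟨j, rfl⟩ := Fin.exists_succ_eq.2 ((Fin.succ_pos i).trans hj).ne'
          simp
      simp only [hybridSum, consPair, Fin.sum_univ_succ, Fin.cons_zero, Fin.cons_succ, h0, h1,
        map_sub]
      ring
    let N : E × (Fin n → E) × (Fin n → F) → ℝ :=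
      fun p => b p.2.2 (ζ p.1) + hybridSum ζ ξ (a' p.1) p.2
    -- For fixed `(x, u, v)` the sum is a constant minus the integrable `b v (ξ y)`, whose mean is
    -- zero.
    have hinner : ∀ p : E × (Fin n → E) × (Fin n → F),
        ∫ y, hybridSum ζ ξ a (consPair n (p, y)) ∂ν = N p := by
      rintro ⟨x, u, v⟩
      simp only [hsplit]
      have hi : Integrable (fun y => b v (ξ y)) ν :=
        (b v).toContinuousLinearMap.integrable_comp hξ
      have h0 : ∫ y, b v (ξ y) ∂ν = 0 := by
        have := (b v).toContinuousLinearMap.integral_comp_comm hξ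
        simpa [hξ0] using this
      rw [integral_sub (integrable_const _) hi, h0]
      simp [N]
    have hint' : Integrable (fun p => hybridSum ζ ξ a (consPair n p)) ((μ.prod Q).prod ν) :=
      hmp.integrable_comp_of_integrable hint
    have hN : Integrable N (μ.prod Q) := by
      have := hint'.integral_prod_left
      simpa only [hinner] using this
    have hNeq : ∫ p, hybridSum ζ ξ a p ∂((Measure.pi fun _ => μ).prod (Measure.pi fun _ => ν)) =
        ∫ x, ∫ p, N (x, p) ∂Q ∂μ := by
      rw [← integral_prod _ hN, ← hmp.map_eq, integral_map hmp.aemeasurable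
        (by rw [hmp.map_eq]; exact hint.aestronglyMeasurable), integral_prod _ hint']
      simp only [hinner]
    rw [hNeq]
    -- The `x`-section of `N` depends on `x` through `w = ζ x` and the coefficients `a' x`. `S`
    -- collects those `w` for which at least one predictable choice of coefficients makes the
    -- section integrable.
    let S : Submodule ℝ W :=
      { carrier := {w | ∃ c, IsHybridPredictable c ∧
          Integrable (fun p => b p.2 w + hybridSum ζ ξ c p) Q}
        add_mem' := by
          rintro w w' ⟨c, hc, h⟩ ⟨c', hc', h'⟩
          refine ⟨fun i u v => c i u v + c' i u v, hc.add hc', ?_⟩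
          · refine (h.add h').congr (.of_forall fun p => ?_)
            simp only [hybridSum, Pi.add_apply, map_add, LinearMap.add_apply,
              Finset.sum_add_distrib]
            ring
        zero_mem' := ⟨fun _ _ _ => 0, fun _ _ _ _ _ _ _ => rfl, by simp [hybridSum]⟩
        smul_mem' := by
          rintro r w ⟨c, hc, h⟩
          refine ⟨fun i u v => r • c i u v, hc.const_smul r, ?_⟩
          · refine (h.const_mul r).congr (.of_forall fun p => ?_)
            simp only [hybridSum, map_smul, LinearMap.smul_apply, smul_eq_mul, mul_add,
              Finset.mul_sum] }
    choose c hc hci using fun w : S => w.2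
    -- Two admissible choices differ by an integrable hybrid sum of length `n`, which has mean zero
    -- by induction. The section integral is thus a function of `w` alone, and it is linear because
    -- admissible choices can be added and scaled.
    have huniq : ∀ (w : W) (c c' : Fin n → (Fin n → E) → (Fin n → F) → W →ₗ[ℝ] ℝ),
        IsHybridPredictable c → IsHybridPredictable c' →
        Integrable (fun p => b p.2 w + hybridSum ζ ξ c p) Q →
        Integrable (fun p => b p.2 w + hybridSum ζ ξ c' p) Q →
        ∫ p, (b p.2 w + hybridSum ζ ξ c p) ∂Q = ∫ p, (b p.2 w + hybridSum ζ ξ c' p) ∂Q := by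
      intro w c c' hc hc' h h'
      have hsub : ∀ p, hybridSum ζ ξ (fun i u v => c i u v - c' i u v) p =
          (b p.2 w + hybridSum ζ ξ c p) - (b p.2 w + hybridSum ζ ξ c' p) := by
        intro p
        simp only [hybridSum, LinearMap.sub_apply, Finset.sum_sub_distrib]
        ring
      have := ih (fun i u v => c i u v - c' i u v)
        (hc.sub hc')
        ((h.sub h').congr (.of_forall fun p => (hsub p).symm))
      simp only [hsub] at this
      rw [integral_sub h h'] at this
      linarith
    let T : S →ₗ[ℝ] ℝ :=
      { toFun := fun w => ∫ p, (b p.2 w + hybridSum ζ ξ (c w) p) ∂Q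
        map_add' := by
          intro w w'
          have hs : ∀ p : (Fin n → E) × (Fin n → F), b p.2 ((w + w' : S) : W) +
              hybridSum ζ ξ (fun i u v => c w i u v + c w' i u v) p =
              (b p.2 w + hybridSum ζ ξ (c w) p) + (b p.2 w' + hybridSum ζ ξ (c w') p) := by
            intro p
            simp only [hybridSum, map_add, LinearMap.add_apply, Submodule.coe_add,
              Finset.sum_add_distrib]
            ring
          rw [huniq _ (c (w + w')) (fun i u v => c w i u v + c w' i u v) (hc _)
            ((hc w).add (hc w')) (hci _)
            (((hci w).add (hci w')).congr (.of_forall fun p => (hs p).symm))]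
          simp only [hs]
          exact integral_add (hci w) (hci w')
        map_smul' := by
          intro r w
          have hs : ∀ p : (Fin n → E) × (Fin n → F), b p.2 ((r • w : S) : W) +
              hybridSum ζ ξ (fun i u v => r • c w i u v) p =
              r * (b p.2 w + hybridSum ζ ξ (c w) p) := by
            intro p
            simp only [hybridSum, map_smul, LinearMap.smul_apply, Submodule.coe_smul, smul_eq_mul,
              mul_add, Finset.mul_sum]
          rw [huniq _ (c (r • w)) (fun i u v => r • c w i u v) (hc _)
            ((hc w).const_smul r) (hci _)
            (((hci w).const_mul r).congr (.of_forall fun p => (hs p).symm))]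
          simp only [hs]
          exact integral_const_mul _ _ }
    refine integral_linearMap_comp_of_submodule hζ hζ0 S T _ ?_
    -- Almost every section of `N` is integrable, so `ζ x ∈ S` with `a' x` as witness.
    filter_upwards [hN.prod_right_ae] with x hx
    refine ⟨⟨a' x, ha' x, hx⟩, huniq (ζ x) _ _ (ha' x) (hc _) hx (hci ⟨ζ x, ⟨a' x, ha' x, hx⟩⟩)⟩

end Predictable

end Augmentation

namespace Augmentation

set_option maxSynthPendingDepth 3

universe w

/-! ### Times differentiable functions -/

section TimesDiff

variable {E F G : Type*} [NormedAddCommGroup E] [NormedSpace ℝ E]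
    [NormedAddCommGroup F] [NormedSpace ℝ F] [NormedAddCommGroup G] [NormedSpace ℝ G]

/-- Currying the last argument is a linear isometry, so differentiability passes between
`iteratedFDeriv` of order `s + 1` and that of order `s` of `fderiv`. This permits induction on `r`.
-/
theorem isTimesDiff_succ_iff {r : ℕ} {f : E → F} :
    IsTimesDiff (r + 1) f ↔ Differentiable ℝ f ∧ IsTimesDiff r (fderiv ℝ f) := by
  have h0 : Differentiable ℝ (iteratedFDeriv ℝ 0 f) ↔ Differentiable ℝ f := by
    rw [iteratedFDeriv_zero_eq_comp]
    exact (continuousMultilinearCurryFin0 ℝ E F).symm.comp_differentiable_iff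
  have hs : ∀ s, Differentiable ℝ (iteratedFDeriv ℝ (s + 1) f) ↔
      Differentiable ℝ (iteratedFDeriv ℝ s (fderiv ℝ f)) := by
    intro s
    have : iteratedFDeriv ℝ (s + 1) f = (continuousMultilinearCurryRightEquiv' ℝ s E F).symm ∘
        iteratedFDeriv ℝ s (fderiv ℝ f) := by
      funext x; exact iteratedFDeriv_succ_eq_comp_right
    rw [this]
    exact (continuousMultilinearCurryRightEquiv' ℝ s E F).symm.comp_differentiable_iff
  constructor
  · intro h
    exact ⟨h0.1 (h 0 r.succ_pos), fun s hs' => (hs s).1 (h (s + 1) (by omega))⟩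
  · rintro ⟨h1, h2⟩ s hs'
    cases s with
    | zero => exact h0.2 h1
    | succ s => exact (hs s).2 (h2 s (by omega))

/-- The top derivative need not be continuous, so closure properties of `ContDiff` do not suffice.
The induction replaces `F` by `E →L[ℝ] F`, which is why all spaces share one universe. -/
theorem IsTimesDiff.clm_comp {E F G : Type w} [NormedAddCommGroup E] [NormedSpace ℝ E]
    [NormedAddCommGroup F] [NormedSpace ℝ F] [NormedAddCommGroup G] [NormedSpace ℝ G] (L : F →L[ℝ] G) {r : ℕ} {f : E → F} (hf : IsTimesDiff r f) :
    IsTimesDiff r fun x => L (f x) := by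
  intro s hs
  induction r generalizing s F G with
  | zero => omega
  | succ r ih =>
    obtain ⟨h1, h2⟩ := isTimesDiff_succ_iff.1 hf
    have : fderiv ℝ (fun x => L (f x)) =
        fun x => ContinuousLinearMap.compL ℝ E F G L (fderiv ℝ f x) := by
      funext x
      exact (L.hasFDerivAt.comp x (h1 x).hasFDerivAt).fderiv
    refine isTimesDiff_succ_iff.2 ⟨L.differentiable.comp h1, fun s hs => ?_⟩ s hs
    change Differentiable ℝ (iteratedFDeriv ℝ s (fderiv ℝ fun x => L (f x)))
    rw [this]
    exact ih _ h2 s hs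

theorem IsTimesDiff.comp_add_clm {E F G : Type w} [NormedAddCommGroup E] [NormedSpace ℝ E]
    [NormedAddCommGroup F] [NormedSpace ℝ F] [NormedAddCommGroup G] [NormedSpace ℝ G] (a : F) (L : E →L[ℝ] F) {r : ℕ} {f : F → G}
    (hf : IsTimesDiff r f) : IsTimesDiff r fun x => f (a + L x) := by
  induction r generalizing G with
  | zero => intro s hs; omega
  | succ r ih =>
    obtain ⟨h1, h2⟩ := isTimesDiff_succ_iff.1 hf
    have : fderiv ℝ (fun x => f (a + L x)) =
        fun x => (ContinuousLinearMap.compL ℝ E F G).flip L (fderiv ℝ f (a + L x)) := by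
      funext x
      exact ((h1 _).hasFDerivAt.comp x (L.hasFDerivAt.const_add a)).fderiv
    refine isTimesDiff_succ_iff.2 ⟨h1.comp (L.differentiable.const_add a), ?_⟩
    rw [this]
    exact (ih h2).clm_comp _

theorem isTimesDiff_three_iff {f : E → F} :
    IsTimesDiff 3 f ↔ Differentiable ℝ f ∧ Differentiable ℝ (fderiv ℝ f) ∧
      Differentiable ℝ (fderiv ℝ (fderiv ℝ f)) := by
  rw [isTimesDiff_succ_iff, isTimesDiff_succ_iff, isTimesDiff_succ_iff]
  simp [IsTimesDiff]

/-- One order is lost: all derivatives below the top one are differentiable and hence continuous. -/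
theorem IsTimesDiff.contDiff {r : ℕ} {f : E → F} (hf : IsTimesDiff (r + 1) f) :
    ContDiff ℝ r f :=
  contDiff_of_differentiable_iteratedFDeriv (n := r)
    fun m hm => hf m (by have : m ≤ r := by exact_mod_cast hm
                         omega)

theorem norm_fderiv_two (f : E → F) (x : E) :
    ‖fderiv ℝ (fderiv ℝ f) x‖ = ‖iteratedFDeriv ℝ 2 f x‖ := by
  rw [← norm_iteratedFDeriv_one, norm_iteratedFDeriv_fderiv]

theorem norm_fderiv_three (f : E → F) (x : E) :
    ‖fderiv ℝ (fderiv ℝ (fderiv ℝ f)) x‖ = ‖iteratedFDeriv ℝ 3 f x‖ := by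
  rw [← norm_iteratedFDeriv_one, norm_iteratedFDeriv_fderiv, norm_iteratedFDeriv_fderiv]

end TimesDiff

/-! ### The flattened norm dominates the operator norm -/

section TensorNorm

variable {ι F : Type*} [Fintype ι] [DecidableEq ι] [NormedAddCommGroup F] [NormedSpace ℝ F]

theorem euclidean_sum_single (x : EuclideanSpace ℝ ι) :
    x = ∑ p, x p • EuclideanSpace.single p (1 : ℝ) := by
  simpa using ((EuclideanSpace.basisFun ι ℝ).sum_repr x).symm

/-- Expand all arguments in the standard basis and apply Cauchy–Schwarz over the multi-indices; the
coordinate factor is exactly `∏ ‖m s‖`. -/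
theorem norm_le_tensorNorm {r : ℕ}
    (T : ContinuousMultilinearMap ℝ (fun _ : Fin r => EuclideanSpace ℝ ι) F) :
    ‖T‖ ≤ tensorNorm T := by
  refine T.opNorm_le_bound (Real.sqrt_nonneg _) fun m => ?_
  have h1 : T m = ∑ c : Fin r → ι,
      (∏ s, m s (c s)) • T fun s => EuclideanSpace.single (c s) (1 : ℝ) := by
    conv_lhs => rw [show m = fun s => ∑ p, m s p • EuclideanSpace.single p (1 : ℝ) from
      funext fun s => euclidean_sum_single (m s)]
    rw [T.map_sum]
    simp only [T.map_smul_univ]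
  have h2 : ∏ s, ‖m s‖ = Real.sqrt (∑ c : Fin r → ι, (∏ s, m s (c s)) ^ 2) := by
    rw [← Real.sqrt_sq (Finset.prod_nonneg fun s _ => norm_nonneg (m s)), ← Finset.prod_pow]
    simp only [← Finset.prod_pow, EuclideanSpace.real_norm_sq_eq]
    rw [Finset.prod_univ_sum, Fintype.piFinset_univ]
  rw [h1, h2]
  calc _ ≤ ∑ c : Fin r → ι, |∏ s, m s (c s)| *
        ‖T fun s => EuclideanSpace.single (c s) (1 : ℝ)‖ := by
        refine (norm_sum_le _ _).trans (Finset.sum_le_sum fun c _ => ?_)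
        rw [norm_smul, Real.norm_eq_abs]
    _ ≤ _ := by
        refine (Real.sum_mul_le_sqrt_mul_sqrt _ _ _).trans ?_
        rw [mul_comm]
        simp [tensorNorm, sq_abs]

theorem tensorNorm_nonneg {r : ℕ}
    (T : ContinuousMultilinearMap ℝ (fun _ : Fin r => EuclideanSpace ℝ ι) F) : 0 ≤ tensorNorm T :=
  Real.sqrt_nonneg _

theorem tensorNorm_zero_index
    (T : ContinuousMultilinearMap ℝ (fun _ : Fin 0 => EuclideanSpace ℝ ι) F) :
    tensorNorm T = ‖T 0‖ := by
  rw [tensorNorm, Fintype.sum_unique, Real.sqrt_sq (norm_nonneg _)]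
  congr 2
  exact Subsingleton.elim _ _

theorem tensorNorm_iteratedFDeriv_one (f : EuclideanSpace ℝ ι → F) (x : EuclideanSpace ℝ ι) :
    tensorNorm (iteratedFDeriv ℝ 1 f x) =
      Real.sqrt (∑ p, ‖fderiv ℝ f x (EuclideanSpace.single p 1)‖ ^ 2) := by
  rw [tensorNorm, ← (Equiv.funUnique (Fin 1) ι).symm.sum_comp]
  simp

theorem tensorNorm_iteratedFDeriv_two (f : EuclideanSpace ℝ ι → F) (x : EuclideanSpace ℝ ι) :
    tensorNorm (iteratedFDeriv ℝ 2 f x) = Real.sqrt (∑ p : ι × ι,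
      ‖fderiv ℝ (fderiv ℝ f) x (EuclideanSpace.single p.1 1) (EuclideanSpace.single p.2 1)‖ ^ 2) := by
  rw [tensorNorm, ← (finTwoArrowEquiv ι).symm.sum_comp]
  simp [iteratedFDeriv_two_apply]

theorem enorm_le_ofReal_tensorNorm {r : ℕ}
    (T : ContinuousMultilinearMap ℝ (fun _ : Fin r => EuclideanSpace ℝ ι) F) {G : Type*}
    [NormedAddCommGroup G] {y : G} (h : ‖y‖ = ‖T‖) : ‖y‖ₑ ≤ ENNReal.ofReal (tensorNorm T) := by
  rw [← ofReal_norm, h]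
  exact ENNReal.ofReal_le_ofReal (norm_le_tensorNorm T)

end TensorNorm

/-! ### Growth of a function with bounded third derivative -/

section Growth

variable {q : ℕ} {h : Vec q → ℝ}

theorem enorm_fderiv_three_le (v : Vec q) :
    ‖fderiv ℝ (fderiv ℝ (fderiv ℝ h)) v‖ₑ ≤ gamma3 h :=
  (enorm_le_ofReal_tensorNorm _ (norm_fderiv_three h v)).trans
    (le_iSup (fun v => ENNReal.ofReal (tensorNorm (iteratedFDeriv ℝ 3 h v))) v)

theorem enorm_fderiv_two_zero_le : ‖fderiv ℝ (fderiv ℝ h) 0‖ₑ ≤ eta 2 h :=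
  enorm_le_ofReal_tensorNorm _ (norm_fderiv_two h 0)

theorem enorm_fderiv_one_zero_le : ‖fderiv ℝ h 0‖ₑ ≤ eta 1 h :=
  enorm_le_ofReal_tensorNorm _ (norm_iteratedFDeriv_one h).symm

/-- A derivative bound by `C` on the segment gives `‖f v‖ ≤ ‖f 0‖ + C ‖v‖`, also for `C = ∞`. -/
theorem enorm_le_add_of_enorm_fderiv_le {E F : Type*} [NormedAddCommGroup E] [NormedSpace ℝ E]
    [NormedAddCommGroup F] [NormedSpace ℝ F] {f : E → F} (hf : Differentiable ℝ f) (v : E)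
    {C : ℝ≥0∞} (hC : ∀ w, ‖w‖ ≤ ‖v‖ → ‖fderiv ℝ f w‖ₑ ≤ C) : ‖f v‖ₑ ≤ ‖f 0‖ₑ + C * ‖v‖ₑ := by
  rcases eq_or_ne v 0 with rfl | hv
  -- The case `v = 0` is separate because `∞ * 0 = 0`; for `v ≠ 0` and `C = ∞` the right side is
  -- infinite.
  · simp
  rcases eq_or_ne C ∞ with rfl | hCt
  · rw [ENNReal.top_mul (by simpa using hv)]
    simp
  lift C to ℝ≥0 using hCt
  have h1 : ‖f v - f 0‖ ≤ C * ‖v - 0‖ := by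
    refine (convex_closedBall (0 : E) ‖v‖).norm_image_sub_le_of_norm_fderiv_le
      (𝕜 := ℝ) (fun x _ => hf x) (fun x hx => ?_) (by simp) (by simp)
    have := hC x (by simpa using hx)
    rw [enorm_le_coe] at this
    exact_mod_cast this
  have h2 : ‖f v‖ ≤ ‖f 0‖ + C * ‖v‖ := by
    have := norm_le_norm_add_norm_sub' (f v) (f 0)
    rw [sub_zero] at h1
    linarith
  rw [← ofReal_norm, ← ofReal_norm, ← ofReal_norm]
  refine (ENNReal.ofReal_le_ofReal h2).trans ?_
  rw [ENNReal.ofReal_add (by positivity) (by positivity), ENNReal.ofReal_mul (by positivity),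
    ENNReal.ofReal_coe_nnreal]

/-- Integrating the bound on `∂³h` outward from the origin controls the lower derivatives by `γ³`
and the values `η` at `0`. Evaluated at `f(W_i)`, this is the source of the factors `α⁰` in `λ₁` and
`λ₂`. -/
theorem enorm_fderiv_two_le (hh : IsTimesDiff 3 h) (v : Vec q) :
    ‖fderiv ℝ (fderiv ℝ h) v‖ₑ ≤ eta 2 h + gamma3 h * ‖v‖ₑ := by
  obtain ⟨-, -, h2⟩ := isTimesDiff_three_iff.1 hh
  refine (enorm_le_add_of_enorm_fderiv_le h2 v fun w _ => enorm_fderiv_three_le w).trans ?_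
  gcongr
  exact enorm_fderiv_two_zero_le

theorem enorm_fderiv_one_le (hh : IsTimesDiff 3 h) (v : Vec q) :
    ‖fderiv ℝ h v‖ₑ ≤ eta 1 h + eta 2 h * ‖v‖ₑ + gamma3 h * ‖v‖ₑ ^ 2 := by
  obtain ⟨-, h1, -⟩ := isTimesDiff_three_iff.1 hh
  refine (enorm_le_add_of_enorm_fderiv_le h1 v (C := eta 2 h + gamma3 h * ‖v‖ₑ)
    fun w hw => ?_).trans ?_
  · refine (enorm_fderiv_two_le hh w).trans ?_
    have : ‖w‖ₑ ≤ ‖v‖ₑ := by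
      rw [← ofReal_norm, ← ofReal_norm]
      exact ENNReal.ofReal_le_ofReal hw
    gcongr
  · rw [add_mul, add_assoc, sq, mul_assoc]
    gcongr
    exact enorm_fderiv_one_zero_le

end Growth

/-! ### Taylor expansion of a composition along a segment -/

section Taylor

theorem exists_taylor_three {g g₁ g₂ g₃ : ℝ → ℝ} (h0 : ∀ t, HasDerivAt g (g₁ t) t)
    (h1 : ∀ t, HasDerivAt g₁ (g₂ t) t) (h2 : ∀ t, HasDerivAt g₂ (g₃ t) t) :
    ∃ t ∈ Set.Ioo (0 : ℝ) 1, g 1 = g 0 + g₁ 0 + 1 / 2 * g₂ 0 + 1 / 6 * g₃ t := by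
  -- `K` makes the auxiliary function below vanish at `1` as well as at `0`. Its first two
  -- derivatives also vanish at `0`, so Rolle's theorem applies three times; no continuity of `g₃`
  -- is needed.
  set K := g 1 - g 0 - g₁ 0 - 1 / 2 * g₂ 0 with hK
  have d0 : ∀ t, HasDerivAt (fun t => g t - g 0 - g₁ 0 * t - 1 / 2 * g₂ 0 * t ^ 2 - K * t ^ 3)
      (g₁ t - g₁ 0 - g₂ 0 * t - 3 * K * t ^ 2) t := by
    intro t
    convert! ((((h0 t).sub_const (g 0)).sub ((hasDerivAt_id t).const_mul (g₁ 0))).sub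
      ((hasDerivAt_pow 2 t).const_mul (1 / 2 * g₂ 0))).sub
      ((hasDerivAt_pow 3 t).const_mul K) using 1
    push_cast; ring
  have d1 : ∀ t, HasDerivAt (fun t => g₁ t - g₁ 0 - g₂ 0 * t - 3 * K * t ^ 2)
      (g₂ t - g₂ 0 - 6 * K * t) t := by
    intro t
    convert! (((h1 t).sub_const (g₁ 0)).sub ((hasDerivAt_id t).const_mul (g₂ 0))).sub
      ((hasDerivAt_pow 2 t).const_mul (3 * K)) using 1
    push_cast; ring
  have d2 : ∀ t, HasDerivAt (fun t => g₂ t - g₂ 0 - 6 * K * t) (g₃ t - 6 * K) t := by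
    intro t
    convert! ((h2 t).sub_const (g₂ 0)).sub ((hasDerivAt_id t).const_mul (6 * K)) using 1
    ring
  obtain ⟨t₁, ht₁, e₁⟩ := exists_hasDerivAt_eq_zero (zero_lt_one' ℝ)
    (fun t _ => (d0 t).continuousAt.continuousWithinAt) (by simp only [hK]; ring) fun t _ => d0 t
  obtain ⟨t₂, ht₂, e₂⟩ := exists_hasDerivAt_eq_zero ht₁.1
    (fun t _ => (d1 t).continuousAt.continuousWithinAt) (by rw [e₁]; ring) fun t _ => d1 t
  obtain ⟨t₃, ht₃, e₃⟩ := exists_hasDerivAt_eq_zero ht₂.1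
    (fun t _ => (d2 t).continuousAt.continuousWithinAt) (by rw [e₂]; ring) fun t _ => d2 t
  exact ⟨t₃, ⟨ht₃.1, ht₃.2.trans (ht₂.2.trans ht₁.2)⟩, by linarith⟩

variable {E V : Type*} [NormedAddCommGroup E] [NormedSpace ℝ E] [NormedAddCommGroup V]
  [NormedSpace ℝ V] {F : E → V} {h : V → ℝ}

theorem hasDerivAt_comp_smul {G : Type*} [NormedAddCommGroup G] [NormedSpace ℝ G] {F : E → G}
    (hF : Differentiable ℝ F) (x : E) (t : ℝ) :
    HasDerivAt (fun t : ℝ => F (t • x)) (fderiv ℝ F (t • x) x) t := by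
  have h1 : HasDerivAt (fun t : ℝ => t • x) x t := by
    simpa using (hasDerivAt_id t).smul_const x
  exact (hF (t • x)).hasFDerivAt.comp_hasDerivAt t h1

/-- The right side is the third derivative of `t ↦ h (F (t • x))`. The two orders of arguments in
the mixed term are kept apart, so symmetry of the second derivative is not used; in norm they add up
to the factor `3` of `λ₂`. -/
theorem exists_taylor_comp (hF : IsTimesDiff 3 F) (hh : IsTimesDiff 3 h) (x : E) :
    ∃ t ∈ Set.Ioo (0 : ℝ) 1,
      h (F x) - h (F 0) - fderiv ℝ h (F 0) (fderiv ℝ F 0 x) -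
        1 / 2 * (fderiv ℝ (fderiv ℝ h) (F 0) (fderiv ℝ F 0 x) (fderiv ℝ F 0 x) +
          fderiv ℝ h (F 0) (fderiv ℝ (fderiv ℝ F) 0 x x)) =
      1 / 6 * (fderiv ℝ (fderiv ℝ (fderiv ℝ h)) (F (t • x)) (fderiv ℝ F (t • x) x)
            (fderiv ℝ F (t • x) x) (fderiv ℝ F (t • x) x) +
          fderiv ℝ (fderiv ℝ h) (F (t • x)) (fderiv ℝ (fderiv ℝ F) (t • x) x x)
            (fderiv ℝ F (t • x) x) +
          2 * fderiv ℝ (fderiv ℝ h) (F (t • x)) (fderiv ℝ F (t • x) x)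
            (fderiv ℝ (fderiv ℝ F) (t • x) x x) +
          fderiv ℝ h (F (t • x)) (fderiv ℝ (fderiv ℝ (fderiv ℝ F)) (t • x) x x x)) := by
  obtain ⟨f0, f1, f2⟩ := isTimesDiff_three_iff.1 hF
  obtain ⟨k0, k1, k2⟩ := isTimesDiff_three_iff.1 hh
  have e0 := hasDerivAt_comp_smul f0 x
  have e1 := fun t => (hasDerivAt_comp_smul f1 x t).clm_apply (hasDerivAt_const t x)
  have e2 := fun t => ((hasDerivAt_comp_smul f2 x t).clm_apply (hasDerivAt_const t x)).clm_apply
    (hasDerivAt_const t x)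
  have c0 := fun t => (k0 (F (t • x))).hasFDerivAt.comp_hasDerivAt t (e0 t)
  have c1 := fun t => (k1 (F (t • x))).hasFDerivAt.comp_hasDerivAt t (e0 t)
  have c2 := fun t => (k2 (F (t • x))).hasFDerivAt.comp_hasDerivAt t (e0 t)
  simp only [map_zero, add_zero] at e1 e2
  obtain ⟨t, ht, H⟩ := exists_taylor_three (g := fun t => h (F (t • x))) c0
    (fun t => (c1 t).clm_apply (e1 t))
    (fun t => (((c2 t).clm_apply (e1 t)).clm_apply (e1 t)).add ((c1 t).clm_apply (e2 t)))
  refine ⟨t, ht, ?_⟩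
  simp only [one_smul, zero_smul, Function.comp_apply, add_apply] at H
  rw [H]
  ring

end Taylor

end Augmentation

namespace Augmentation

/-! ### Hölder inequalities for `normL` -/

section Holder

variable {Ω : Type*} [MeasurableSpace Ω] {P : Measure Ω}

theorem normL_mono {m : ℕ} {u v : Ω → ℝ≥0∞} (h : ∀ ω, u ω ≤ v ω) : normL P m u ≤ normL P m v := by
  unfold normL
  gcongr with ω
  exact h ω

theorem normL_one (u : Ω → ℝ≥0∞) : normL P 1 u = ∫⁻ ω, u ω ∂P := by
  simp [normL]

theorem pow_rpow_div {m : ℕ} (hm : m ≠ 0) (x : ℝ≥0∞) : (x ^ m) ^ ((1 : ℝ) / m) = x := by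
  rw [← ENNReal.rpow_natCast, ← ENNReal.rpow_mul, mul_one_div_cancel (by exact_mod_cast hm),
    ENNReal.rpow_one]

theorem lintegral_mul_le_normL_two {u v : Ω → ℝ≥0∞} (hu : Measurable u) (hv : Measurable v) :
    ∫⁻ ω, u ω * v ω ∂P ≤ normL P 2 u * normL P 2 v := by
  have h := ENNReal.lintegral_mul_norm_pow_le (μ := P) (hu.pow_const 2).aemeasurable
    (hv.pow_const 2).aemeasurable (p := (1 : ℝ) / (2 : ℕ)) (q := (1 : ℝ) / (2 : ℕ)) (by norm_num)
    (by norm_num) (by norm_num)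
  simpa only [pow_rpow_div two_ne_zero, normL] using h

theorem lintegral_mul_mul_le_normL_three {u v w : Ω → ℝ≥0∞} (hu : Measurable u)
    (hv : Measurable v) (hw : Measurable w) :
    ∫⁻ ω, u ω * v ω * w ω ∂P ≤ normL P 3 u * normL P 3 v * normL P 3 w := by
  have h := ENNReal.lintegral_prod_norm_pow_le (μ := P) (Finset.univ : Finset (Fin 3))
    (f := ![fun ω => u ω ^ 3, fun ω => v ω ^ 3, fun ω => w ω ^ 3])
    (p := fun _ => (1 : ℝ) / (3 : ℕ))
    (by intro i _; fin_cases i <;> simp <;> fun_prop) (by norm_num) (by intros; norm_num)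
  simpa only [Fin.prod_univ_three, Matrix.cons_val_zero, Matrix.cons_val_one, Matrix.cons_val,
    pow_rpow_div three_ne_zero, normL] using h

theorem lintegral_mul_pow_three_le {u x : Ω → ℝ≥0∞} (hu : Measurable u) (hx : Measurable x) :
    ∫⁻ ω, u ω * x ω ^ 3 ∂P ≤ normL P 2 u * (∫⁻ ω, x ω ^ 6 ∂P) ^ ((1 : ℝ) / 2) := by
  have h := lintegral_mul_le_normL_two (P := P) hu (hx.pow_const 3)
  simpa only [normL, ← pow_mul, Nat.cast_ofNat] using h

theorem lintegral_mul_mul_pow_three_le {u v x : Ω → ℝ≥0∞} (hu : Measurable u)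
    (hv : Measurable v) (hx : Measurable x) :
    ∫⁻ ω, u ω * v ω * x ω ^ 3 ∂P ≤
      normL P 4 u * normL P 4 v * (∫⁻ ω, x ω ^ 6 ∂P) ^ ((1 : ℝ) / 2) := by
  have h := ENNReal.lintegral_prod_norm_pow_le (μ := P) (Finset.univ : Finset (Fin 3))
    (f := ![fun ω => u ω ^ 4, fun ω => v ω ^ 4, fun ω => (x ω ^ 3) ^ 2])
    (p := ![(1 : ℝ) / (4 : ℕ), (1 : ℝ) / (4 : ℕ), (1 : ℝ) / (2 : ℕ)])
    (by intro i _; fin_cases i <;> simp <;> fun_prop) (by simp [Fin.sum_univ_three]; norm_num)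
    (by intro i _; fin_cases i <;> norm_num)
  simp only [Fin.prod_univ_three, Matrix.cons_val_zero, Matrix.cons_val_one, Matrix.cons_val,
    pow_rpow_div four_ne_zero, pow_rpow_div two_ne_zero] at h
  simpa only [normL, ← pow_mul, Nat.cast_ofNat] using h

/-- Hölder with `1/6 + 1/6 + 1/6 + 1/2 = 1`. The cube always takes the exponent `2`, and the
derivative factors share the remaining half, which is why `λ₂` contains `L₆`, `L₄` and `L₂` norms.
-/
theorem lintegral_mul_mul_mul_pow_three_le {u v w x : Ω → ℝ≥0∞} (hu : Measurable u)
    (hv : Measurable v) (hw : Measurable w) (hx : Measurable x) :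
    ∫⁻ ω, u ω * v ω * w ω * x ω ^ 3 ∂P ≤
      normL P 6 u * normL P 6 v * normL P 6 w * (∫⁻ ω, x ω ^ 6 ∂P) ^ ((1 : ℝ) / 2) := by
  have h6 : (6 : ℕ) ≠ 0 := by norm_num
  have h := ENNReal.lintegral_prod_norm_pow_le (μ := P) (Finset.univ : Finset (Fin 4))
    (f := ![fun ω => u ω ^ 6, fun ω => v ω ^ 6, fun ω => w ω ^ 6, fun ω => (x ω ^ 3) ^ 2])
    (p := ![(1 : ℝ) / (6 : ℕ), (1 : ℝ) / (6 : ℕ), (1 : ℝ) / (6 : ℕ), (1 : ℝ) / (2 : ℕ)])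
    (by intro i _; fin_cases i <;> simp <;> fun_prop) (by simp [Fin.sum_univ_four]; norm_num)
    (by intro i _; fin_cases i <;> norm_num)
  simp only [Fin.prod_univ_four, Matrix.cons_val_zero, Matrix.cons_val_one, Matrix.cons_val,
    pow_rpow_div h6, pow_rpow_div two_ne_zero] at h
  simpa only [normL, ← pow_mul, Nat.cast_ofNat] using h

/-- The bound of order two, with measurable derivative norms `t₀, t₁, t₂`. -/
theorem lintegral_second_order_le {t₀ t₁ t₂ : Ω → ℝ≥0∞} (h0 : Measurable t₀)
    (h1 : Measurable t₁) (h2 : Measurable t₂) (γ η₂ η₁ : ℝ≥0∞) :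
    ∫⁻ ω, ((η₂ + γ * t₀ ω) * t₁ ω ^ 2 + (η₁ + η₂ * t₀ ω + γ * t₀ ω ^ 2) * t₂ ω) ∂P ≤
      γ * (normL P 3 t₀ * normL P 3 t₁ ^ 2 + normL P 3 t₀ ^ 2 * normL P 3 t₂) +
        η₂ * (normL P 2 t₁ ^ 2 + normL P 2 t₀ * normL P 2 t₂) + η₁ * normL P 1 t₂ := by
  have e : ∀ ω, (η₂ + γ * t₀ ω) * t₁ ω ^ 2 + (η₁ + η₂ * t₀ ω + γ * t₀ ω ^ 2) * t₂ ω =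
      γ * (t₀ ω * t₁ ω * t₁ ω + t₀ ω * t₀ ω * t₂ ω) + η₂ * (t₁ ω * t₁ ω + t₀ ω * t₂ ω) +
        η₁ * t₂ ω := fun ω => by ring
  simp only [e]
  rw [lintegral_add_left (by fun_prop), lintegral_add_left (by fun_prop),
    lintegral_const_mul _ (by fun_prop), lintegral_const_mul _ (by fun_prop),
    lintegral_const_mul _ (by fun_prop), lintegral_add_left (by fun_prop),
    lintegral_add_left (by fun_prop), normL_one, sq, sq, sq, ← mul_assoc]
  gcongr
  · exact lintegral_mul_mul_le_normL_three h0 h1 h1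
  · exact lintegral_mul_mul_le_normL_three h0 h0 h2
  · exact lintegral_mul_le_normL_two h1 h1
  · exact lintegral_mul_le_normL_two h0 h2

/-- If a measurable function is dominated by `a + b * s` with `s` arbitrary, then `s` may be
replaced by a measurable function. -/
theorem exists_measurable_le_of_le_add_mul {R a b s : Ω → ℝ≥0∞} (hR : Measurable R)
    (ha : Measurable a) (hb : Measurable b) (hbt : ∀ ω, b ω ≠ ∞) (h : ∀ ω, R ω ≤ a ω + b ω * s ω) :
    ∃ s', Measurable s' ∧ (∀ ω, s' ω ≤ s ω) ∧ ∀ ω, R ω ≤ a ω + b ω * s' ω := by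
  -- The witness is the least `s'` compatible with the bound, a quotient of measurable functions.
  refine ⟨fun ω => (R ω - a ω) / b ω, (hR.sub ha).div hb, fun ω => ?_, fun ω => ?_⟩
  · refine ENNReal.div_le_of_le_mul ?_
    rw [mul_comm]
    exact tsub_le_iff_left.2 (h ω)
  · rcases eq_or_ne (b ω) 0 with hb0 | hb0
    · simpa [hb0] using h ω
    · rw [ENNReal.mul_div_cancel hb0 (hbt ω)]
      exact tsub_le_iff_left.1 le_rfl

/-- The bound of order three. The norm `s₃` of the third derivative need not be measurable. -/
theorem lintegral_third_order_le {R s₀ s₁ s₂ s₃ x H : Ω → ℝ≥0∞} (hR : Measurable R)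
    (h0 : Measurable s₀) (h1 : Measurable s₁) (h2 : Measurable s₂) (hx : Measurable x)
    (hH : Measurable H) (hxt : ∀ ω, x ω ≠ ∞) (hHt : ∀ ω, H ω ≠ ∞) {c γ η₂ η₁ : ℝ≥0∞} (hc : c ≠ ∞)
    (hH' : ∀ ω, H ω ≤ η₁ + η₂ * s₀ ω + γ * s₀ ω ^ 2)
    (hR' : ∀ ω, R ω ≤ c * x ω ^ 3 * (γ * s₁ ω ^ 3 + 3 * (η₂ + γ * s₀ ω) * s₁ ω * s₂ ω) +
      c * x ω ^ 3 * H ω * s₃ ω) :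
    ∫⁻ ω, R ω ∂P ≤ c * (∫⁻ ω, x ω ^ 6 ∂P) ^ ((1 : ℝ) / 2) *
      (γ * (normL P 6 s₁ ^ 3 + 3 * normL P 6 s₀ * normL P 6 s₁ * normL P 6 s₂ +
          normL P 6 s₀ ^ 2 * normL P 6 s₃) +
        η₂ * (3 * normL P 4 s₁ * normL P 4 s₂ + normL P 4 s₀ * normL P 4 s₃) +
        η₁ * normL P 2 s₃) := by
  -- The division requires a finite coefficient of `s₃`. This is why `H` is used first and its
  -- growth bound, which may be infinite, is inserted only afterwards.
  obtain ⟨s, hs, hs3, hRs⟩ := exists_measurable_le_of_le_add_mul hR (by fun_prop) (by fun_prop)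
    (fun ω => ENNReal.mul_ne_top (ENNReal.mul_ne_top hc (ENNReal.pow_ne_top (hxt ω))) (hHt ω)) hR'
  have h3 : ∀ m, normL P m s ≤ normL P m s₃ := fun m => normL_mono hs3
  set X := (∫⁻ ω, x ω ^ 6 ∂P) ^ ((1 : ℝ) / 2) with hX
  calc ∫⁻ ω, R ω ∂P
      ≤ ∫⁻ ω, c * (γ * (s₁ ω * s₁ ω * s₁ ω * x ω ^ 3 + 3 * (s₀ ω * s₁ ω * s₂ ω * x ω ^ 3) +
          s₀ ω * s₀ ω * s ω * x ω ^ 3) + η₂ * (3 * (s₁ ω * s₂ ω * x ω ^ 3) +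
          s₀ ω * s ω * x ω ^ 3) + η₁ * (s ω * x ω ^ 3)) ∂P := by
        refine lintegral_mono fun ω => (hRs ω).trans ?_
        calc _ ≤ c * x ω ^ 3 * (γ * s₁ ω ^ 3 + 3 * (η₂ + γ * s₀ ω) * s₁ ω * s₂ ω) +
              c * x ω ^ 3 * (η₁ + η₂ * s₀ ω + γ * s₀ ω ^ 2) * s ω := by
              gcongr
              exact hH' ω
          _ = _ := by ring
    _ ≤ c * (γ * (normL P 6 s₁ * normL P 6 s₁ * normL P 6 s₁ * X +
          3 * (normL P 6 s₀ * normL P 6 s₁ * normL P 6 s₂ * X) +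
          normL P 6 s₀ * normL P 6 s₀ * normL P 6 s₃ * X) +
        η₂ * (3 * (normL P 4 s₁ * normL P 4 s₂ * X) + normL P 4 s₀ * normL P 4 s₃ * X) +
        η₁ * (normL P 2 s₃ * X)) := by
        rw [lintegral_const_mul _ (by fun_prop), lintegral_add_left (by fun_prop),
          lintegral_add_left (by fun_prop), lintegral_const_mul _ (by fun_prop),
          lintegral_const_mul _ (by fun_prop), lintegral_const_mul _ (by fun_prop),
          lintegral_add_left (by fun_prop), lintegral_add_left (by fun_prop),
          lintegral_add_left (by fun_prop), lintegral_const_mul _ (by fun_prop),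
          lintegral_const_mul _ (by fun_prop)]
        gcongr
        · exact lintegral_mul_mul_mul_pow_three_le h1 h1 h1 hx
        · exact lintegral_mul_mul_mul_pow_three_le h0 h1 h2 hx
        · refine (lintegral_mul_mul_mul_pow_three_le h0 h0 hs hx).trans ?_
          gcongr
          exact h3 6
        · exact lintegral_mul_mul_pow_three_le h1 h2 hx
        · refine (lintegral_mul_mul_pow_three_le h0 hs hx).trans ?_
          gcongr
          exact h3 4
        · refine (lintegral_mul_pow_three_le hs hx).trans ?_
          gcongr
          exact h3 2
    _ = _ := by ring

end Holder

/-! ### Suprema of continuous functions along segments -/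

section SegmentSup

variable {S : Type*}

/-- `sup_{t ∈ [0,1]} ψ(p, t)`. -/
noncomputable def unitSup (ψ : S → ℝ → ℝ) (p : S) : ℝ≥0∞ :=
  ⨆ t : Set.Icc (0 : ℝ) 1, ENNReal.ofReal (ψ p t)

theorem le_unitSup (ψ : S → ℝ → ℝ) (p : S) {t : ℝ} (ht : t ∈ Set.Icc (0 : ℝ) 1) :
    ENNReal.ofReal (ψ p t) ≤ unitSup ψ p :=
  le_iSup (fun t : Set.Icc (0 : ℝ) 1 => ENNReal.ofReal (ψ p t)) ⟨t, ht⟩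

variable [TopologicalSpace S]

/-- An uncountable supremum of continuous functions is lower semicontinuous, hence measurable. -/
theorem measurable_unitSup [MeasurableSpace S] [OpensMeasurableSpace S] {ψ : S → ℝ → ℝ}
    (hψ : Continuous (Function.uncurry ψ)) : Measurable (unitSup ψ) := by
  have : LowerSemicontinuous (unitSup ψ) := by
    refine lowerSemicontinuous_iSup fun t => Continuous.lowerSemicontinuous ?_
    exact ENNReal.continuous_ofReal.comp (hψ.comp (by fun_prop : Continuous fun p => (p, (t : ℝ))))
  exact this.measurable

theorem unitSup_ne_top {ψ : S → ℝ → ℝ} (hψ : Continuous (Function.uncurry ψ)) (p : S) :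
    unitSup ψ p ≠ ∞ := by
  have hc : Continuous (ψ p) := hψ.comp (by fun_prop : Continuous fun t : ℝ => (p, t))
  obtain ⟨C, hC⟩ := (isCompact_Icc (a := (0 : ℝ)) (b := 1)).bddAbove_image hc.continuousOn
  refine ne_top_of_le_ne_top (b := ENNReal.ofReal C) ENNReal.ofReal_ne_top (iSup_le fun t => ?_)
  exact ENNReal.ofReal_le_ofReal (hC ⟨t, t.2, rfl⟩)

end SegmentSup

end Augmentation

namespace Augmentation

set_option maxSynthPendingDepth 3

/-! ### Second order expansion of a composition, and its remainder -/

section Expansion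

variable {ι : Type*} [Fintype ι] [DecidableEq ι] {q : ℕ}

/-- The vector of the coordinates of `x` together with the matrix `x ⊗ x`. -/
def quadFeature (x : EuclideanSpace ℝ ι) : (ι → ℝ) × (ι × ι → ℝ) :=
  (fun p => x p, fun p => x p.1 * x p.2)

/-- The partial derivatives at `0` of `h ∘ F`. -/
noncomputable def gradCoef (h : Vec q → ℝ) (F : EuclideanSpace ℝ ι → Vec q) (p : ι) : ℝ :=
  fderiv ℝ h (F 0) (fderiv ℝ F 0 (EuclideanSpace.single p 1))

/-- The second partial derivatives at `0` of `h ∘ F`. -/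
noncomputable def hessCoef (h : Vec q → ℝ) (F : EuclideanSpace ℝ ι → Vec q) (p : ι × ι) : ℝ :=
  fderiv ℝ (fderiv ℝ h) (F 0) (fderiv ℝ F 0 (EuclideanSpace.single p.1 1))
      (fderiv ℝ F 0 (EuclideanSpace.single p.2 1)) +
    fderiv ℝ h (F 0) (fderiv ℝ (fderiv ℝ F) 0 (EuclideanSpace.single p.1 1)
      (EuclideanSpace.single p.2 1))

/-- The second order Taylor polynomial of `h ∘ F` at `0`, without its constant term, as a linear
function of the first and second powers of the argument. -/
noncomputable def taylorCoef (h : Vec q → ℝ) (F : EuclideanSpace ℝ ι → Vec q) :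
    (ι → ℝ) × (ι × ι → ℝ) →ₗ[ℝ] ℝ :=
  (∑ p, gradCoef h F p • LinearMap.proj p) ∘ₗ LinearMap.fst ℝ _ _ +
    ((1 / 2 : ℝ) • ∑ p, hessCoef h F p • LinearMap.proj p) ∘ₗ LinearMap.snd ℝ _ _

theorem taylorCoef_apply (h : Vec q → ℝ) (F : EuclideanSpace ℝ ι → Vec q)
    (w : (ι → ℝ) × (ι × ι → ℝ)) : taylorCoef h F w =
      ∑ p, gradCoef h F p * w.1 p + 1 / 2 * ∑ p, hessCoef h F p * w.2 p := by
  simp [taylorCoef]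

theorem taylorCoef_quadFeature (h : Vec q → ℝ) (F : EuclideanSpace ℝ ι → Vec q)
    (x : EuclideanSpace ℝ ι) : taylorCoef h F (quadFeature x) =
      fderiv ℝ h (F 0) (fderiv ℝ F 0 x) +
        1 / 2 * (fderiv ℝ (fderiv ℝ h) (F 0) (fderiv ℝ F 0 x) (fderiv ℝ F 0 x) +
          fderiv ℝ h (F 0) (fderiv ℝ (fderiv ℝ F) 0 x x)) := by
  have h1 : fderiv ℝ h (F 0) (fderiv ℝ F 0 x) = ∑ p, gradCoef h F p * x p := by
    conv_lhs => rw [euclidean_sum_single x]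
    simp only [map_sum, map_smul, smul_eq_mul, gradCoef]
    exact Finset.sum_congr rfl fun p _ => mul_comm _ _
  have h2 : fderiv ℝ (fderiv ℝ h) (F 0) (fderiv ℝ F 0 x) (fderiv ℝ F 0 x) +
      fderiv ℝ h (F 0) (fderiv ℝ (fderiv ℝ F) 0 x x) =
      ∑ p, hessCoef h F p * (x p.1 * x p.2) := by
    conv_lhs => rw [euclidean_sum_single x]
    simp only [map_sum, map_smul, smul_eq_mul, hessCoef, Fintype.sum_prod_type, sum_apply,
      smul_apply, Finset.mul_sum, ← Finset.sum_add_distrib]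
    rw [Finset.sum_comm]
    exact Finset.sum_congr rfl fun p _ => Finset.sum_congr rfl fun p' _ => by ring
  rw [taylorCoef_apply, h1, h2]
  rfl

/-- The remainder of the second order Taylor expansion of `h ∘ F` at `0`. -/
noncomputable def taylorRem (h : Vec q → ℝ) (F : EuclideanSpace ℝ ι → Vec q)
    (x : EuclideanSpace ℝ ι) : ℝ :=
  h (F x) - h (F 0) - taylorCoef h F (quadFeature x)

theorem enorm_clm_apply_le {E F : Type*} [NormedAddCommGroup E] [NormedSpace ℝ E]
    [NormedAddCommGroup F] [NormedSpace ℝ F] (L : E →L[ℝ] F) {x : E} {a b : ℝ≥0∞}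
    (hL : ‖L‖ₑ ≤ a) (hx : ‖x‖ₑ ≤ b) : ‖L x‖ₑ ≤ a * b :=
  (L.le_opENorm x).trans (by gcongr)

/-- The bound `H` on `h'` along the segment stays a separate factor so that the coefficient of the
third derivative of `F` can be kept finite. -/
theorem enorm_taylorRem_le {h : Vec q → ℝ} (hh : IsTimesDiff 3 h)
    {F : EuclideanSpace ℝ ι → Vec q} (hF : IsTimesDiff 3 F) (x : EuclideanSpace ℝ ι)
    {s : ℕ → ℝ≥0∞} {H : ℝ≥0∞}
    (hs : ∀ r, ∀ t ∈ Set.Icc (0 : ℝ) 1,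
      ENNReal.ofReal (tensorNorm (iteratedFDeriv ℝ r F (t • x))) ≤ s r)
    (hH : ∀ t ∈ Set.Icc (0 : ℝ) 1, ‖fderiv ℝ h (F (t • x))‖ₑ ≤ H) :
    ‖taylorRem h F x‖ₑ ≤ ENNReal.ofReal (1 / 6) * ‖x‖ₑ ^ 3 *
        (gamma3 h * s 1 ^ 3 + 3 * (eta 2 h + gamma3 h * s 0) * s 1 * s 2) +
      ENNReal.ofReal (1 / 6) * ‖x‖ₑ ^ 3 * H * s 3 := by
  obtain ⟨t, ht, e⟩ := exists_taylor_comp hF hh x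
  have ht' : t ∈ Set.Icc (0 : ℝ) 1 := Set.Ioo_subset_Icc_self ht
  rw [taylorRem, taylorCoef_quadFeature, ← sub_sub, e]
  have b0 : ‖F (t • x)‖ₑ ≤ s 0 := by
    refine le_trans ?_ (hs 0 t ht')
    exact enorm_le_ofReal_tensorNorm _ norm_iteratedFDeriv_zero.symm
  have b1 : ‖fderiv ℝ F (t • x) x‖ₑ ≤ s 1 * ‖x‖ₑ :=
    enorm_clm_apply_le _ ((enorm_le_ofReal_tensorNorm _
      (norm_iteratedFDeriv_one F).symm).trans (hs 1 t ht')) le_rfl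
  have b2 : ‖fderiv ℝ (fderiv ℝ F) (t • x) x x‖ₑ ≤ s 2 * ‖x‖ₑ * ‖x‖ₑ :=
    enorm_clm_apply_le _ (enorm_clm_apply_le _ ((enorm_le_ofReal_tensorNorm _
      (norm_fderiv_two F _)).trans (hs 2 t ht')) le_rfl) le_rfl
  have b3 : ‖fderiv ℝ (fderiv ℝ (fderiv ℝ F)) (t • x) x x x‖ₑ ≤ s 3 * ‖x‖ₑ * ‖x‖ₑ * ‖x‖ₑ :=
    enorm_clm_apply_le _ (enorm_clm_apply_le _ (enorm_clm_apply_le _ ((enorm_le_ofReal_tensorNorm _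
      (norm_fderiv_three F _)).trans (hs 3 t ht')) le_rfl) le_rfl) le_rfl
  have k2 : ‖fderiv ℝ (fderiv ℝ h) (F (t • x))‖ₑ ≤ eta 2 h + gamma3 h * s 0 :=
    (enorm_fderiv_two_le hh _).trans (by gcongr)
  have a1 := enorm_clm_apply_le _ (enorm_clm_apply_le _ (enorm_clm_apply_le _
    (enorm_fderiv_three_le (h := h) (F (t • x))) b1) b1) b1
  have a2 := enorm_clm_apply_le _ (enorm_clm_apply_le _ k2 b2) b1
  have a3 := enorm_clm_apply_le _ (enorm_clm_apply_le _ k2 b1) b2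
  have a4 := enorm_clm_apply_le _ (hH t ht') b3
  have h6 : ‖(1 / 6 : ℝ)‖ₑ = ENNReal.ofReal (1 / 6) := Real.enorm_of_nonneg (by norm_num)
  have h2 : ‖(2 : ℝ)‖ₑ = 2 := by
    rw [Real.enorm_of_nonneg (by norm_num)]; simp
  rw [enorm_mul, h6]
  calc _ ≤ ENNReal.ofReal (1 / 6) *
      (gamma3 h * (s 1 * ‖x‖ₑ) * (s 1 * ‖x‖ₑ) * (s 1 * ‖x‖ₑ) +
        (eta 2 h + gamma3 h * s 0) * (s 2 * ‖x‖ₑ * ‖x‖ₑ) * (s 1 * ‖x‖ₑ) +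
        2 * ((eta 2 h + gamma3 h * s 0) * (s 1 * ‖x‖ₑ) * (s 2 * ‖x‖ₑ * ‖x‖ₑ)) +
        H * (s 3 * ‖x‖ₑ * ‖x‖ₑ * ‖x‖ₑ)) := by
        gcongr
        refine (enorm_add_le _ _).trans (add_le_add ((enorm_add_le _ _).trans (add_le_add
          ((enorm_add_le _ _).trans (add_le_add a1 a2)) ?_)) a4)
        rw [enorm_mul, h2]
        gcongr
    _ = _ := by ring

/-- Cauchy–Schwarz over pairs of coordinates, applied to the two parts of the Hessian. In the first
part, `u p.1 * u p.2` has Euclidean norm exactly `tensorNorm (iteratedFDeriv ℝ 1 F 0) ^ 2`. -/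
theorem enorm_hessCoef_mul_le {h : Vec q → ℝ} (hh : IsTimesDiff 3 h)
    (F : EuclideanSpace ℝ ι → Vec q) (C : ι × ι → ℝ) {t₀ t₁ t₂ : ℝ≥0∞}
    (h0 : t₀ = ENNReal.ofReal (tensorNorm (iteratedFDeriv ℝ 0 F 0)))
    (h1 : t₁ = ENNReal.ofReal (tensorNorm (iteratedFDeriv ℝ 1 F 0)))
    (h2 : t₂ = ENNReal.ofReal (tensorNorm (iteratedFDeriv ℝ 2 F 0))) :
    ‖∑ p, hessCoef h F p * C p‖ₑ ≤ ((eta 2 h + gamma3 h * t₀) * t₁ ^ 2 +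
      (eta 1 h + eta 2 h * t₀ + gamma3 h * t₀ ^ 2) * t₂) *
        ENNReal.ofReal (Real.sqrt (∑ p, C p ^ 2)) := by
  have b0 : ‖F 0‖ₑ = t₀ := by
    rw [h0, tensorNorm_zero_index, iteratedFDeriv_zero_apply, ofReal_norm]
  set N := Real.sqrt (∑ p, C p ^ 2)
  set u : ι → ℝ := fun p => ‖fderiv ℝ F 0 (EuclideanSpace.single p 1)‖ with hu
  set u2 : ι × ι → ℝ := fun p => ‖fderiv ℝ (fderiv ℝ F) 0 (EuclideanSpace.single p.1 1)
    (EuclideanSpace.single p.2 1)‖ with hu2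
  have key : |∑ p, hessCoef h F p * C p| ≤
      (‖fderiv ℝ (fderiv ℝ h) (F 0)‖ * tensorNorm (iteratedFDeriv ℝ 1 F 0) ^ 2 +
        ‖fderiv ℝ h (F 0)‖ * tensorNorm (iteratedFDeriv ℝ 2 F 0)) * N := by
    have c1 : ∑ p : ι × ι, u p.1 * u p.2 * |C p| ≤
        tensorNorm (iteratedFDeriv ℝ 1 F 0) ^ 2 * N := by
      refine (Real.sum_mul_le_sqrt_mul_sqrt _ _ _).trans (le_of_eq ?_)
      simp only [sq_abs]
      congr 1
      rw [tensorNorm_iteratedFDeriv_one, Real.sq_sqrt (by positivity), Fintype.sum_prod_type]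
      simp only [mul_pow, ← Finset.mul_sum, ← Finset.sum_mul]
      exact Real.sqrt_mul_self (by positivity)
    have c2 : ∑ p : ι × ι, u2 p * |C p| ≤ tensorNorm (iteratedFDeriv ℝ 2 F 0) * N := by
      refine (Real.sum_mul_le_sqrt_mul_sqrt _ _ _).trans (le_of_eq ?_)
      simp only [sq_abs]
      rw [tensorNorm_iteratedFDeriv_two]
    calc |∑ p, hessCoef h F p * C p|
        ≤ ∑ p, |hessCoef h F p * C p| := Finset.abs_sum_le_sum_abs _ _
      _ ≤ ∑ p : ι × ι, (‖fderiv ℝ (fderiv ℝ h) (F 0)‖ * (u p.1 * u p.2 * |C p|) +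
            ‖fderiv ℝ h (F 0)‖ * (u2 p * |C p|)) := by
          refine Finset.sum_le_sum fun p _ => ?_
          rw [abs_mul]
          have : |hessCoef h F p| ≤ ‖fderiv ℝ (fderiv ℝ h) (F 0)‖ * (u p.1 * u p.2) +
              ‖fderiv ℝ h (F 0)‖ * u2 p := by
            refine (abs_add_le _ _).trans (add_le_add ?_ ?_)
            · have := ((fderiv ℝ (fderiv ℝ h) (F 0)).le_opNorm₂
                (fderiv ℝ F 0 (EuclideanSpace.single p.1 1))
                (fderiv ℝ F 0 (EuclideanSpace.single p.2 1)))
              rw [← mul_assoc]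
              exact this
            · exact (fderiv ℝ h (F 0)).le_opNorm _
          calc _ ≤ _ := mul_le_mul_of_nonneg_right this (abs_nonneg _)
            _ = _ := by ring
      _ ≤ _ := by
          rw [Finset.sum_add_distrib, ← Finset.mul_sum, ← Finset.mul_sum, add_mul, mul_assoc,
            mul_assoc]
          gcongr
  have hN : 0 ≤ N := Real.sqrt_nonneg _
  rw [← ofReal_norm, Real.norm_eq_abs]
  refine (ENNReal.ofReal_le_ofReal key).trans ?_
  have hT1 := tensorNorm_nonneg (iteratedFDeriv ℝ 1 F 0)
  have hT2 := tensorNorm_nonneg (iteratedFDeriv ℝ 2 F 0)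
  rw [ENNReal.ofReal_mul (by positivity), ENNReal.ofReal_add (by positivity) (by positivity),
    ENNReal.ofReal_mul (by positivity), ENNReal.ofReal_mul (by positivity),
    ENNReal.ofReal_pow hT1, ofReal_norm, ofReal_norm, ← h1, ← h2, ← b0]
  gcongr
  · exact enorm_fderiv_two_le hh _
  · exact enorm_fderiv_one_le hh _

end Expansion

/-! ### Hybrid configurations -/

section Hybrid

variable {n k d q : ℕ}

/-- The function `w ↦ f (W_i(w))`. -/
def hybridSlice (f : (Fin n → Blk k d) → Vec q) (i : Fin n) (y z : Fin n → Blk k d) (w : Blk k d) :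
    Vec q :=
  f (hybrid y z i w)

/-- The hybrid is affine in its free block, so slices of `f` inherit differentiability and their
derivatives are restrictions of those of `f`. -/
theorem hybrid_eq_add_single (y z : Fin n → Blk k d) (i : Fin n) (w : Blk k d) :
    hybrid y z i w = hybrid y z i 0 + ContinuousLinearMap.single ℝ (fun _ => Blk k d) i w := by
  funext j
  rcases lt_trichotomy j i with hj | rfl | hj
  · simp [hybrid, hj, Pi.single_eq_of_ne hj.ne]
  · simp [hybrid]
  · simp [hybrid, hj.not_gt, hj.ne']

theorem hybrid_apply_self (y z : Fin n → Blk k d) (i : Fin n) (w : Blk k d) :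
    hybrid y z i w i = w := by
  simp [hybrid]

theorem update_hybrid (y z : Fin n → Blk k d) (i : Fin n) (w u : Blk k d) :
    Function.update (hybrid y z i w) i u = hybrid y z i u := by
  funext j
  rcases eq_or_ne j i with rfl | hj
  · simp [hybrid]
  · simp [hybrid, hj]

theorem blockDeriv_hybrid (r : ℕ) (f : (Fin n → Blk k d) → Vec q) (i : Fin n)
    (y z : Fin n → Blk k d) (w : Blk k d) :
    blockDeriv r f i (hybrid y z i w) = iteratedFDeriv ℝ r (hybridSlice f i y z) w := by
  simp only [blockDeriv, update_hybrid, hybrid_apply_self]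
  rfl

theorem continuous_hybrid {S : Type*} [TopologicalSpace S] {y z : S → Fin n → Blk k d}
    {w : S → Blk k d} (hy : Continuous y) (hz : Continuous z) (hw : Continuous w) (i : Fin n) :
    Continuous fun s => hybrid (y s) (z s) i (w s) := by
  refine continuous_pi fun j => ?_
  simp only [hybrid]
  split_ifs
  · exact (continuous_apply j).comp hy
  · exact hw
  · exact (continuous_apply j).comp hz

theorem isTimesDiff_hybridSlice {r : ℕ} {f : (Fin n → Blk k d) → Vec q} (hf : IsTimesDiff r f)
    (i : Fin n) (y z : Fin n → Blk k d) : IsTimesDiff r (hybridSlice f i y z) := by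
  have := hf.comp_add_clm (hybrid y z i 0) (ContinuousLinearMap.single ℝ (fun _ => Blk k d) i)
  simp only [← hybrid_eq_add_single] at this
  exact this

theorem iteratedFDeriv_hybridSlice_apply {r : ℕ} {f : (Fin n → Blk k d) → Vec q}
    (hf : ContDiff ℝ r f) (i : Fin n) (y z : Fin n → Blk k d) (w : Blk k d)
    (m : Fin r → Blk k d) : iteratedFDeriv ℝ r (hybridSlice f i y z) w m =
      iteratedFDeriv ℝ r f (hybrid y z i w) fun s =>
        ContinuousLinearMap.single ℝ (fun _ => Blk k d) i (m s) := by
  have h1 : hybridSlice f i y z = (fun v => f (v + hybrid y z i 0)) ∘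
      ContinuousLinearMap.single ℝ (fun _ => Blk k d) i := by
    funext w
    simp only [hybridSlice, Function.comp_apply]
    rw [hybrid_eq_add_single y z i w, add_comm]
  have h2 : ContDiff ℝ r fun v => f (v + hybrid y z i 0) := by fun_prop
  rw [h1, ContinuousLinearMap.iteratedFDeriv_comp_right _ h2 _ le_rfl, hybrid_eq_add_single y z i w,
    iteratedFDeriv_comp_add_right, add_comm]
  rfl

theorem continuous_iteratedFDeriv_hybridSlice {S : Type*} [TopologicalSpace S] {r : ℕ}
    {f : (Fin n → Blk k d) → Vec q} (hf : ContDiff ℝ r f) (i : Fin n)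
    {y z : S → Fin n → Blk k d} {w : S → Blk k d} (hy : Continuous y) (hz : Continuous z)
    (hw : Continuous w) (m : Fin r → Blk k d) :
    Continuous fun s => iteratedFDeriv ℝ r (hybridSlice f i (y s) (z s)) (w s) m := by
  simp only [iteratedFDeriv_hybridSlice_apply hf]
  exact (continuous_eval_const _).comp
    ((hf.continuous_iteratedFDeriv le_rfl).comp (continuous_hybrid hy hz hw i))

theorem continuous_tensorNorm_hybridSlice {S : Type*} [TopologicalSpace S] {r : ℕ}
    {f : (Fin n → Blk k d) → Vec q} (hf : ContDiff ℝ r f) (i : Fin n)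
    {y z : S → Fin n → Blk k d} {w : S → Blk k d} (hy : Continuous y) (hz : Continuous z)
    (hw : Continuous w) :
    Continuous fun s => tensorNorm (iteratedFDeriv ℝ r (hybridSlice f i (y s) (z s)) (w s)) := by
  refine Real.continuous_sqrt.comp (continuous_finsetSum _ fun c _ => ?_)
  exact (continuous_iteratedFDeriv_hybridSlice hf i hy hz hw _).norm.pow 2

theorem ofReal_tensorNorm_le_supDeriv (r : ℕ) (f : (Fin n → Blk k d) → Vec q) (i : Fin n)
    (y z : Fin n → Blk k d) (x : Blk k d) {t : ℝ} (ht : t ∈ Set.Icc (0 : ℝ) 1) :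
    ENNReal.ofReal (tensorNorm (iteratedFDeriv ℝ r (hybridSlice f i y z) (t • x))) ≤
      supDeriv r f y z i x := by
  rw [← blockDeriv_hybrid]
  have hmem : t • x ∈ segment ℝ 0 x := ⟨1 - t, t, by linarith [ht.2], ht.1, by ring, by simp⟩
  exact le_iSup₂ (f := fun w _ => ENNReal.ofReal (tensorNorm (blockDeriv r f i (hybrid y z i w))))
    (t • x) hmem

theorem supDeriv_eq_unitSup (r : ℕ) (f : (Fin n → Blk k d) → Vec q) (i : Fin n)
    (y z : Fin n → Blk k d) (x : Blk k d) : supDeriv r f y z i x =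
      unitSup (fun (_ : Unit) t => tensorNorm (iteratedFDeriv ℝ r (hybridSlice f i y z) (t • x)))
        () := by
  apply le_antisymm
  · refine iSup₂_le fun w hw => ?_
    obtain ⟨a, t, ha, ht, hat, rfl⟩ := hw
    rw [blockDeriv_hybrid, smul_zero, zero_add]
    exact le_unitSup (fun (_ : Unit) t =>
      tensorNorm (iteratedFDeriv ℝ r (hybridSlice f i y z) (t • x))) () ⟨ht, by linarith⟩
  · exact iSup_le fun t => ofReal_tensorNorm_le_supDeriv r f i y z x t.2

theorem measurable_supDeriv {S : Type*} [TopologicalSpace S] [MeasurableSpace S]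
    [OpensMeasurableSpace S] {r : ℕ} {f : (Fin n → Blk k d) → Vec q} (hf : ContDiff ℝ r f)
    (i : Fin n) {y z : S → Fin n → Blk k d} {x : S → Blk k d} (hy : Continuous y)
    (hz : Continuous z) (hx : Continuous x) :
    Measurable fun s => supDeriv r f (y s) (z s) i (x s) := by
  simp only [supDeriv_eq_unitSup]
  exact measurable_unitSup (ψ := fun s t =>
    tensorNorm (iteratedFDeriv ℝ r (hybridSlice f i (y s) (z s)) (t • x s)))
    (continuous_tensorNorm_hybridSlice hf i (hy.comp continuous_fst) (hz.comp continuous_fst)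
      (continuous_snd.smul (hx.comp continuous_fst)))

end Hybrid

end Augmentation

namespace Augmentation

set_option maxSynthPendingDepth 3

/-! ### Covariance matrices -/

theorem posSemidef_covariance {Ω ι : Type*} [MeasurableSpace Ω] [Fintype ι] {P : Measure Ω}
    [IsProbabilityMeasure P] {g : ι → Ω → ℝ} (hg : ∀ a, MemLp (g a) 2 P) :
    (Matrix.of fun a b => cov[g a, g b; P]).PosSemidef := by
  refine .of_dotProduct_mulVec_nonneg ?_ fun x => ?_
  · ext a b
    simp [covariance_comm]
  · have h : star x ⬝ᵥ ((Matrix.of fun a b => cov[g a, g b; P]).mulVec x) =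
        cov[fun ω => ∑ a, x a * g a ω, fun ω => ∑ b, x b * g b ω; P] := by
      rw [covariance_fun_sum_fun_sum (fun a => (hg a).const_mul _) (fun b => (hg b).const_mul _)]
      simp only [covariance_const_mul_left, covariance_const_mul_right, dotProduct, Matrix.mulVec,
        Matrix.of_apply, Finset.mul_sum, star_trivial]
      exact Finset.sum_congr rfl fun a _ => Finset.sum_congr rfl fun b _ => by ring
    rw [h, covariance_self (Finset.aemeasurable_fun_sum _ fun a _ =>
      ((hg a).const_mul _).aemeasurable)]
    exact variance_nonneg _ _

/-! ### Moments of the augmented data -/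

section Moments

variable {d : ℕ} {𝒯 : Type*} [MeasurableSpace 𝒯] {ev : 𝒯 → Vec d → Vec d}
  {μ : Measure (Vec d)} {ν : Measure 𝒯}

theorem memLp_phiX_apply (hmom : MemLp (phiX ev) 2 (tripleLaw μ ν)) (a : Fin d) :
    MemLp (fun p => phiX ev p a) 2 (tripleLaw μ ν) :=
  (memLp_piLp_iff.1 hmom) a

variable [IsProbabilityMeasure μ] [IsProbabilityMeasure ν]

instance isProbabilityMeasure_tripleLaw : IsProbabilityMeasure (tripleLaw μ ν) := by
  unfold tripleLaw; infer_instance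

/-- The conditional mean of `φX` given `X = x`. -/
noncomputable def condMean (ev : 𝒯 → Vec d → Vec d) (ν : Measure 𝒯) (a : Fin d) (x : Vec d) : ℝ :=
  ∫ t, ev t x a ∂ν

theorem measurePreserving_tripleLaw_swap :
    MeasurePreserving (fun p : Vec d × 𝒯 × 𝒯 => (p.1, p.2.2, p.2.1)) (tripleLaw μ ν)
      (tripleLaw μ ν) :=
  (MeasurePreserving.id μ).prod (Measure.measurePreserving_swap (μ := ν) (ν := ν))

theorem memLp_psiX_apply (hmom : MemLp (phiX ev) 2 (tripleLaw μ ν)) (a : Fin d) :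
    MemLp (fun p => psiX ev p a) 2 (tripleLaw μ ν) :=
  (memLp_phiX_apply hmom a).comp_measurePreserving measurePreserving_tripleLaw_swap

theorem meanAug_apply (hmom : MemLp (phiX ev) 2 (tripleLaw μ ν)) (a : Fin d) :
    meanAug ev μ ν a = ∫ p, phiX ev p a ∂(tripleLaw μ ν) :=
  eval_integral_piLp (fun a => (memLp_phiX_apply hmom a).integrable one_le_two) a

theorem stronglyMeasurable_condMean (hev : Measurable (Function.uncurry ev)) (a : Fin d) :
    StronglyMeasurable (condMean ev ν a) := by
  have h : Measurable fun p : Vec d × 𝒯 => ev p.2 p.1 a := by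
    have : Measurable fun p : Vec d × 𝒯 => ev p.2 p.1 := hev.comp measurable_swap
    fun_prop
  exact h.stronglyMeasurable.integral_prod_right'

/-- Conditioning on `X` means integrating out the independent transformation, by Fubini on the
cylinder sets `t ×ˢ univ`. -/
theorem condExp_phiX (hev : Measurable (Function.uncurry ev))
    (hmom : MemLp (phiX ev) 2 (tripleLaw μ ν)) (a : Fin d) :
    (tripleLaw μ ν)[fun p => phiX ev p a |
      MeasurableSpace.comap (Prod.fst : Vec d × 𝒯 × 𝒯 → Vec d) inferInstance] =ᵐ[tripleLaw μ ν]
      fun p => condMean ev ν a p.1 := by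
  have hU : Integrable (fun p => phiX ev p a) (μ.prod (ν.prod ν)) :=
    (memLp_phiX_apply hmom a).integrable one_le_two
  have hin : ∀ x, ∫ p : 𝒯 × 𝒯, phiX ev (x, p) a ∂(ν.prod ν) = condMean ev ν a x := by
    intro x
    simp only [phiX]
    rw [integral_fun_fst fun t => ev t x a]
    simp [condMean]
  have hg : Integrable (condMean ev ν a) μ := by
    have := hU.integral_prod_left
    simpa only [hin] using this
  have hG : Integrable (fun p : Vec d × 𝒯 × 𝒯 => condMean ev ν a p.1) (μ.prod (ν.prod ν)) :=
    hg.comp_fst _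
  refine (ae_eq_condExp_of_forall_setIntegral_eq measurable_fst.comap_le hU
    (fun s _ _ => hG.integrableOn) ?_ ?_).symm
  · rintro s ⟨t, ht, rfl⟩ _
    have hs : (Prod.fst ⁻¹' t : Set (Vec d × 𝒯 × 𝒯)) = t ×ˢ Set.univ := by ext; simp
    rw [hs, setIntegral_prod _ hG.integrableOn, setIntegral_prod _ hU.integrableOn]
    simp only [Measure.restrict_univ, hin]
    simp
  · exact ((stronglyMeasurable_condMean hev a).comp_measurable
      (comap_measurable _)).aestronglyMeasurable

theorem memLp_condMean (hev : Measurable (Function.uncurry ev))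
    (hmom : MemLp (phiX ev) 2 (tripleLaw μ ν)) (a : Fin d) :
    MemLp (fun p : Vec d × 𝒯 × 𝒯 => condMean ev ν a p.1) 2 (tripleLaw μ ν) :=
  ((memLp_phiX_apply hmom a).condExp one_le_two).ae_eq (condExp_phiX hev hmom a)

/-- Given `X`, the two transformations are independent, so the conditional mean of the product
factorises. -/
theorem integral_tripleLaw_mul {u v : 𝒯 → Vec d → ℝ}
    (h : Integrable (fun p : Vec d × 𝒯 × 𝒯 => u p.2.1 p.1 * v p.2.2 p.1) (tripleLaw μ ν)) :
    ∫ p, u p.2.1 p.1 * v p.2.2 p.1 ∂(tripleLaw μ ν) =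
      ∫ x, (∫ t, u t x ∂ν) * ∫ t, v t x ∂ν ∂μ := by
  rw [tripleLaw, integral_prod _ h]
  exact integral_congr_ae (.of_forall fun x => integral_prod_mul (fun t => u t x) fun t => v t x)

theorem integral_phiX_mul_psiX (hmom : MemLp (phiX ev) 2 (tripleLaw μ ν)) (a b : Fin d) :
    ∫ p, phiX ev p a * psiX ev p b ∂(tripleLaw μ ν) =
      ∫ x, condMean ev ν a x * condMean ev ν b x ∂μ :=
  integral_tripleLaw_mul (u := fun t x => ev t x a) (v := fun t x => ev t x b)
    ((memLp_phiX_apply hmom a).integrable_mul (memLp_psiX_apply hmom b))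

theorem integral_phiX_mul_condMean (hev : Measurable (Function.uncurry ev))
    (hmom : MemLp (phiX ev) 2 (tripleLaw μ ν)) (a b : Fin d) :
    ∫ p, phiX ev p a * condMean ev ν b p.1 ∂(tripleLaw μ ν) =
      ∫ x, condMean ev ν a x * condMean ev ν b x ∂μ := by
  refine (integral_tripleLaw_mul (u := fun t x => ev t x a) (v := fun _ x => condMean ev ν b x)
    ((memLp_phiX_apply hmom a).integrable_mul (memLp_condMean hev hmom b))).trans ?_
  simp [condMean]

theorem integral_condMean_mul_condMean (a b : Fin d) :
    ∫ p, condMean ev ν a p.1 * condMean ev ν b p.1 ∂(tripleLaw μ ν) =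
      ∫ x, condMean ev ν a x * condMean ev ν b x ∂μ := by
  rw [tripleLaw, integral_fun_fst fun x => condMean ev ν a x * condMean ev ν b x]
  simp

theorem integral_psiX (hmom : MemLp (phiX ev) 2 (tripleLaw μ ν)) (a : Fin d) :
    ∫ p, psiX ev p a ∂(tripleLaw μ ν) = meanAug ev μ ν a := by
  have h := measurePreserving_tripleLaw_swap (μ := μ) (ν := ν)
  rw [meanAug_apply hmom]
  conv_rhs => rw [← h.map_eq]
  rw [integral_map h.aemeasurable
    (by rw [h.map_eq]; exact (memLp_phiX_apply hmom a).aestronglyMeasurable)]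
  rfl

theorem Sigma11_apply (hmom : MemLp (phiX ev) 2 (tripleLaw μ ν)) (a b : Fin d) :
    Sigma11 ev μ ν a b = ∫ p, phiX ev p a * phiX ev p b ∂(tripleLaw μ ν) -
      meanAug ev μ ν a * meanAug ev μ ν b := by
  rw [meanAug_apply hmom, meanAug_apply hmom]
  exact covariance_eq_sub (memLp_phiX_apply hmom a) (memLp_phiX_apply hmom b)

theorem Sigma12_apply (hmom : MemLp (phiX ev) 2 (tripleLaw μ ν)) (a b : Fin d) :
    Sigma12 ev μ ν a b = ∫ p, phiX ev p a * psiX ev p b ∂(tripleLaw μ ν) -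
      meanAug ev μ ν a * meanAug ev μ ν b := by
  rw [← integral_psiX hmom b, meanAug_apply hmom]
  exact covariance_eq_sub (memLp_phiX_apply hmom a) (memLp_psiX_apply hmom b)

theorem integral_condMean (hev : Measurable (Function.uncurry ev))
    (hmom : MemLp (phiX ev) 2 (tripleLaw μ ν)) (a : Fin d) :
    ∫ p, condMean ev ν a p.1 ∂(tripleLaw μ ν) = meanAug ev μ ν a := by
  rw [← integral_congr_ae (condExp_phiX hev hmom a), integral_condExp measurable_fst.comap_le,
    meanAug_apply hmom]

/-- By conditional independence, the covariance of `φX` and `ψX` is that of the conditional mean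
with itself. In this form positive semidefiniteness is visible. -/
theorem Sigma12_eq_covariance_condMean (hev : Measurable (Function.uncurry ev))
    (hmom : MemLp (phiX ev) 2 (tripleLaw μ ν)) :
    Sigma12 ev μ ν = Matrix.of fun a b => cov[fun p => condMean ev ν a p.1,
      fun p => condMean ev ν b p.1; tripleLaw μ ν] := by
  ext a b
  rw [Sigma12_apply hmom, Matrix.of_apply,
    covariance_eq_sub (memLp_condMean hev hmom a) (memLp_condMean hev hmom b),
    integral_condMean hev hmom, integral_condMean hev hmom, integral_phiX_mul_psiX hmom,
    ← integral_condMean_mul_condMean]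
  rfl

theorem posSemidef_Sigma12 (hev : Measurable (Function.uncurry ev))
    (hmom : MemLp (phiX ev) 2 (tripleLaw μ ν)) : (Sigma12 ev μ ν).PosSemidef := by
  rw [Sigma12_eq_covariance_condMean hev hmom]
  exact posSemidef_covariance (memLp_condMean hev hmom)

/-- The law of total covariance: after expansion, both mixed terms and the last one are the second
moment of the conditional mean. -/
theorem integral_sub_condMean_mul (hev : Measurable (Function.uncurry ev))
    (hmom : MemLp (phiX ev) 2 (tripleLaw μ ν)) (a b : Fin d) :
    ∫ p, (phiX ev p a - condMean ev ν a p.1) * (phiX ev p b - condMean ev ν b p.1)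
      ∂(tripleLaw μ ν) = Sigma11 ev μ ν a b - Sigma12 ev μ ν a b := by
  have hU := memLp_phiX_apply hmom
  have hG := memLp_condMean hev hmom
  have e : ∀ p, (phiX ev p a - condMean ev ν a p.1) * (phiX ev p b - condMean ev ν b p.1) =
      phiX ev p a * phiX ev p b - phiX ev p a * condMean ev ν b p.1 -
        (phiX ev p b * condMean ev ν a p.1 - condMean ev ν a p.1 * condMean ev ν b p.1) :=
    fun p => by ring
  have i1 := (hU a).integrable_mul (hU b)
  have i2 := (hU a).integrable_mul (hG b)
  have i3 := (hU b).integrable_mul (hG a)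
  have i4 := (hG a).integrable_mul (hG b)
  simp only [e]
  refine (integral_sub (i1.sub i2) (i3.sub i4)).trans ?_
  refine (congrArg₂ (· - ·) (integral_sub i1 i2) (integral_sub i3 i4)).trans ?_
  simp only [Pi.mul_apply]
  rw [integral_phiX_mul_condMean hev hmom, integral_phiX_mul_condMean hev hmom,
    integral_condMean_mul_condMean, Sigma11_apply hmom, Sigma12_apply hmom,
    integral_phiX_mul_psiX hmom]
  simp only [mul_comm (condMean ev ν b _)]
  ring

theorem expCondVar_phiX (hev : Measurable (Function.uncurry ev))
    (hmom : MemLp (phiX ev) 2 (tripleLaw μ ν)) :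
    expCondVar (tripleLaw μ ν)
      (MeasurableSpace.comap (Prod.fst : Vec d × 𝒯 × 𝒯 → Vec d) inferInstance) (phiX ev) =
      Sigma11 ev μ ν - Sigma12 ev μ ν := by
  ext a b
  rw [Matrix.sub_apply, ← integral_sub_condMean_mul hev hmom, expCondVar, Matrix.of_apply,
    integral_condExp measurable_fst.comap_le]
  refine integral_congr_ae ?_
  filter_upwards [condExp_phiX hev hmom a, condExp_phiX hev hmom b] with p ha hb
  rw [ha, hb]

theorem posSemidef_Sigma11_sub_Sigma12 (hev : Measurable (Function.uncurry ev))
    (hmom : MemLp (phiX ev) 2 (tripleLaw μ ν)) :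
    (Sigma11 ev μ ν - Sigma12 ev μ ν).PosSemidef := by
  have hU := memLp_phiX_apply hmom
  have hG := memLp_condMean hev hmom
  have hD : ∀ a, MemLp (fun p => phiX ev p a - condMean ev ν a p.1) 2 (tripleLaw μ ν) :=
    fun a => (hU a).sub (hG a)
  have h0 : ∀ a, ∫ p, phiX ev p a - condMean ev ν a p.1 ∂(tripleLaw μ ν) = 0 := by
    intro a
    rw [integral_sub ((hU a).integrable one_le_two) ((hG a).integrable one_le_two),
      integral_condMean hev hmom, ← meanAug_apply hmom, sub_self]
  convert! posSemidef_covariance hD using 1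
  ext a b
  rw [Matrix.of_apply, covariance_eq_sub (hD a) (hD b), h0, zero_mul, sub_zero, Matrix.sub_apply,
    ← integral_sub_condMean_mul hev hmom]
  rfl

theorem posSemidef_surrogateCov (k : ℕ) (hev : Measurable (Function.uncurry ev))
    (hmom : MemLp (phiX ev) 2 (tripleLaw μ ν)) {δ : ℝ} (hδ : δ ∈ Set.Icc (0 : ℝ) 1) :
    (surrogateCov k δ ev μ ν).PosSemidef := by
  -- Regrouping as `I ⊗ (1-δ)(Σ₁₁ - Σ₁₂) + 11ᵀ ⊗ Σ₁₂` exhibits a sum of Kronecker products of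
  -- positive semidefinite matrices; `δ ≤ 1` enters here.
  have e : surrogateCov k δ ev μ ν =
      (1 : Matrix (Fin k) (Fin k) ℝ) ⊗ₖ ((1 - δ) • (Sigma11 ev μ ν - Sigma12 ev μ ν)) +
        Matrix.vecMulVec (fun _ : Fin k => (1 : ℝ)) (star fun _ => (1 : ℝ)) ⊗ₖ Sigma12 ev μ ν := by
    ext ⟨i, a⟩ ⟨j, b⟩
    simp [surrogateCov, Matrix.vecMulVec_apply]
    ring
  rw [e]
  exact (Matrix.PosSemidef.one.kronecker ((posSemidef_Sigma11_sub_Sigma12 hev hmom).smul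
    (by linarith [hδ.2]))).add ((Matrix.posSemidef_vecMulVec_self_star _).kronecker
    (posSemidef_Sigma12 hev hmom))

end Moments

end Augmentation

namespace Augmentation

set_option maxSynthPendingDepth 3

/-! ### The law of the augmented data -/

section Law

variable {d : ℕ} {𝒯 : Type*} [MeasurableSpace 𝒯]

/-- The block `(t_1 x, …, t_k x)`. -/
def blockMap {k : ℕ} (ev : 𝒯 → Vec d → Vec d) (w : Vec d × (Fin k → 𝒯)) : Blk k d :=
  WithLp.toLp 2 fun p : Fin k × Fin d => ev (w.2 p.1) w.1 p.2

theorem measurable_blockMap {k : ℕ} {ev : 𝒯 → Vec d → Vec d}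
    (hev : Measurable (Function.uncurry ev)) : Measurable (blockMap (k := k) ev) := by
  refine (WithLp.measurable_toLp 2 _).comp (measurable_pi_lambda _ fun p => ?_)
  have h : Measurable fun w : Vec d × (Fin k → 𝒯) => Function.uncurry ev (w.2 p.1, w.1) :=
    hev.comp (by fun_prop)
  have h2 : Measurable fun v : Vec d => v p.2 := by fun_prop
  exact h2.comp h

/-- The law of one block `(φ_1 X, …, φ_k X)`. -/
noncomputable def blockLaw (k : ℕ) (ev : 𝒯 → Vec d → Vec d) (μ : Measure (Vec d))
    (ν : Measure 𝒯) : Measure (Blk k d) :=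
  (μ.prod (Measure.pi fun _ : Fin k => ν)).map (blockMap ev)

theorem map_curry_pi {n k : ℕ} (ν : Measure 𝒯) [IsProbabilityMeasure ν] :
    (Measure.pi fun _ : Fin n × Fin k => ν).map (fun w i j => w (i, j)) =
      Measure.pi fun _ : Fin n => Measure.pi fun _ : Fin k => ν := by
  have h : (Measure.pi fun _ : Fin n × Fin k => ν) =
      (Measure.pi fun _ : Fin n => Measure.pi fun _ : Fin k => ν).map fun w p => w p.1 p.2 := by
    refine Measure.pi_eq fun s hs => ?_
    rw [Measure.map_apply (by fun_prop) (.univ_pi hs)]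
    have : (fun (w : Fin n → Fin k → 𝒯) (p : Fin n × Fin k) => w p.1 p.2) ⁻¹' (Set.univ.pi s) =
        Set.univ.pi fun i => Set.univ.pi fun j => s (i, j) := by
      ext w; simp [Set.mem_pi]
    rw [this, Measure.pi_pi]
    simp only [Measure.pi_pi, Fintype.prod_prod_type]
  rw [h, Measure.map_map (by fun_prop) (by fun_prop)]
  exact Measure.map_id

variable {ev : 𝒯 → Vec d → Vec d} {μ : Measure (Vec d)} {ν : Measure 𝒯}
  {n k : ℕ} {Ω : Type*} [MeasurableSpace Ω] {P : Measure Ω} {X : Fin n → Ω → Vec d}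
  {φ : Fin n → Fin k → Ω → 𝒯}

theorem measurable_augmentedData (hev : Measurable (Function.uncurry ev))
    (hs : IsSample P μ ν X φ) : Measurable (augmentedData ev φ X) := by
  refine measurable_pi_lambda _ fun i => ?_
  have hX := hs.measurable_X i
  have hφ := hs.measurable_φ i
  exact (measurable_blockMap hev).comp (hX.prodMk (measurable_pi_lambda _ hφ))

variable [IsProbabilityMeasure μ] [IsProbabilityMeasure ν]

theorem isProbabilityMeasure_blockLaw (hev : Measurable (Function.uncurry ev)) :
    IsProbabilityMeasure (blockLaw k ev μ ν) :=
  Measure.isProbabilityMeasure_map (measurable_blockMap hev).aemeasurable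

variable [IsProbabilityMeasure P]

/-- The joint law of data and transformations is a product. Regrouping it by the index `i` gives `n`
independent pairs, which are then mapped blockwise. -/
theorem map_augmentedData (hev : Measurable (Function.uncurry ev)) (hs : IsSample P μ ν X φ) :
    P.map (augmentedData ev φ X) = Measure.pi fun _ => blockLaw k ev μ ν := by
  have hX := hs.measurable_X
  have hφ := hs.measurable_φ
  have h1 : P.map (fun ω i => X i ω) = Measure.pi fun _ => μ := by
    rw [(iIndepFun_iff_map_fun_eq_pi_map fun i => (hX i).aemeasurable).1 hs.indep_X]
    simp only [hs.law_X]
  have h2 : P.map (fun ω i j => φ i j ω) =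
      Measure.pi fun _ : Fin n => Measure.pi fun _ : Fin k => ν := by
    have := (iIndepFun_iff_map_fun_eq_pi_map fun p : Fin n × Fin k =>
      (hφ p.1 p.2).aemeasurable).1 hs.indep_φ
    simp only [hs.law_φ] at this
    rw [← map_curry_pi, ← this, Measure.map_map (by fun_prop) (by fun_prop)]
    rfl
  have h3 : P.map (fun ω => ((fun i => X i ω), fun i j => φ i j ω)) =
      (Measure.pi fun _ => μ).prod (Measure.pi fun _ : Fin n => Measure.pi fun _ : Fin k => ν) := by
    rw [(indepFun_iff_map_prod_eq_prod_map_map (by fun_prop) (by fun_prop)).1 hs.indep_X_φ, h1, h2]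
  have h4 : P.map (fun ω i => (X i ω, fun j => φ i j ω)) =
      Measure.pi fun _ : Fin n => μ.prod (Measure.pi fun _ : Fin k => ν) := by
    have := (measurePreserving_arrowProdEquivProdArrow (Vec d) (Fin k → 𝒯) (Fin n)
      (fun _ => μ) (fun _ => Measure.pi fun _ : Fin k => ν)).symm
    rw [← this.map_eq, ← h3, Measure.map_map (MeasurableEquiv.measurable _) (by fun_prop)]
    rfl
  have := isProbabilityMeasure_blockLaw (k := k) (μ := μ) (ν := ν) hev
  have h5 := Measure.pi_map_pi (μ := fun _ : Fin n => μ.prod (Measure.pi fun _ : Fin k => ν))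
    (f := fun _ => blockMap ev) (hμ := fun _ => inferInstanceAs (SigmaFinite (blockLaw k ev μ ν)))
    (fun _ => (measurable_blockMap hev).aemeasurable)
  have hF : Measurable fun (x : Fin n → Vec d × (Fin k → 𝒯)) i => blockMap ev (x i) :=
    measurable_pi_lambda _ fun i => (measurable_blockMap hev).comp (measurable_pi_apply i)
  rw [← h4, Measure.map_map hF (by fun_prop)] at h5
  exact h5

theorem measurePreserving_tripleLaw_fst :
    MeasurePreserving (fun p : Vec d × 𝒯 × 𝒯 => (p.1, p.2.1)) (tripleLaw μ ν) (μ.prod ν) :=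
  (MeasurePreserving.id μ).prod measurePreserving_fst

theorem measurePreserving_eval_one (j : Fin k) :
    MeasurePreserving (fun w : Vec d × (Fin k → 𝒯) => (w.1, w.2 j))
      (μ.prod (Measure.pi fun _ : Fin k => ν)) (μ.prod ν) :=
  (MeasurePreserving.id μ).prod (measurePreserving_eval (fun _ : Fin k => ν) j)

theorem measurePreserving_eval_two {j j' : Fin k} (hj : j ≠ j') :
    MeasurePreserving (fun w : Vec d × (Fin k → 𝒯) => (w.1, w.2 j, w.2 j'))
      (μ.prod (Measure.pi fun _ : Fin k => ν)) (tripleLaw μ ν) := by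
  have h := (iIndepFun_pi (μ := fun _ : Fin k => ν) (X := fun _ t => t)
    fun _ => aemeasurable_id).indepFun hj
  have h0 : MeasurePreserving (fun t : Fin k → 𝒯 => (t j, t j')) (Measure.pi fun _ => ν)
      (ν.prod ν) := ⟨by fun_prop, ?_⟩
  · exact (MeasurePreserving.id μ).prod h0
  rw [(indepFun_iff_map_prod_eq_prod_map_map (measurable_pi_apply j).aemeasurable
    (measurable_pi_apply j').aemeasurable).1 h, (measurePreserving_eval (fun _ : Fin k => ν) j).map_eq,
    (measurePreserving_eval (fun _ : Fin k => ν) j').map_eq]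

/-- Integrals over one transformation of a block are moments of `φX`. -/
theorem lintegral_block_one {g : Vec d × 𝒯 → ℝ≥0∞} (hg : Measurable g) (j : Fin k) :
    ∫⁻ w, g (w.1, w.2 j) ∂(μ.prod (Measure.pi fun _ : Fin k => ν)) =
      ∫⁻ p, g (p.1, p.2.1) ∂(tripleLaw μ ν) := by
  rw [(measurePreserving_eval_one j).lintegral_comp hg,
    measurePreserving_tripleLaw_fst.lintegral_comp hg]

theorem integral_block_one {g : Vec d × 𝒯 → ℝ} (hg : Measurable g) (j : Fin k) :
    ∫ w, g (w.1, w.2 j) ∂(μ.prod (Measure.pi fun _ : Fin k => ν)) =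
      ∫ p, g (p.1, p.2.1) ∂(tripleLaw μ ν) := by
  have h1 := measurePreserving_eval_one (μ := μ) (ν := ν) j
  have h2 := measurePreserving_tripleLaw_fst (μ := μ) (ν := ν)
  rw [← integral_map (f := g) h1.aemeasurable hg.aestronglyMeasurable, h1.map_eq, ← h2.map_eq,
    integral_map h2.aemeasurable hg.aestronglyMeasurable]

theorem measurable_ev_apply (hev : Measurable (Function.uncurry ev)) (a : Fin d) :
    Measurable fun p : Vec d × 𝒯 => ev p.2 p.1 a := by
  have : Measurable fun p : Vec d × 𝒯 => ev p.2 p.1 := hev.comp measurable_swap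
  fun_prop

theorem memLp_blockMap_apply (hev : Measurable (Function.uncurry ev))
    (hmom : MemLp (phiX ev) 2 (tripleLaw μ ν)) (p : Fin k × Fin d) :
    MemLp (fun w => blockMap ev w p) 2 (μ.prod (Measure.pi fun _ : Fin k => ν)) := by
  have hm := measurable_ev_apply hev p.2
  have h : MemLp (fun p' : Vec d × 𝒯 => ev p'.2 p'.1 p.2) 2 (μ.prod ν) := by
    rw [← measurePreserving_tripleLaw_fst.map_eq]
    exact (memLp_map_measure_iff hm.aestronglyMeasurable
      measurePreserving_tripleLaw_fst.aemeasurable).2 (memLp_phiX_apply hmom p.2)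
  exact h.comp_measurePreserving (measurePreserving_eval_one p.1)

theorem memLp_blockLaw_apply (hev : Measurable (Function.uncurry ev))
    (hmom : MemLp (phiX ev) 2 (tripleLaw μ ν)) (p : Fin k × Fin d) :
    MemLp (fun y : Blk k d => y p) 2 (blockLaw k ev μ ν) :=
  (memLp_map_measure_iff (by fun_prop) (measurable_blockMap hev).aemeasurable).2
    (memLp_blockMap_apply hev hmom p)

theorem integral_blockLaw_apply (hev : Measurable (Function.uncurry ev))
    (hmom : MemLp (phiX ev) 2 (tripleLaw μ ν)) (p : Fin k × Fin d) :
    ∫ y, y p ∂(blockLaw k ev μ ν) = meanAug ev μ ν p.2 := by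
  rw [blockLaw, integral_map (measurable_blockMap hev).aemeasurable (by fun_prop),
    meanAug_apply hmom]
  exact integral_block_one (measurable_ev_apply hev p.2) p.1

theorem integral_blockLaw_mul (hev : Measurable (Function.uncurry ev))
    (hmom : MemLp (phiX ev) 2 (tripleLaw μ ν)) (p p' : Fin k × Fin d) :
    ∫ y, y p * y p' ∂(blockLaw k ev μ ν) =
      (if p.1 = p'.1 then Sigma11 ev μ ν p.2 p'.2 else Sigma12 ev μ ν p.2 p'.2) +
        meanAug ev μ ν p.2 * meanAug ev μ ν p'.2 := by
  rw [blockLaw, integral_map (measurable_blockMap hev).aemeasurable (by fun_prop)]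
  obtain ⟨j, a⟩ := p
  obtain ⟨j', b⟩ := p'
  rcases eq_or_ne j j' with rfl | hj
  · rw [if_pos rfl, Sigma11_apply hmom, sub_add_cancel]
    exact integral_block_one ((measurable_ev_apply hev a).mul (measurable_ev_apply hev b)) j
  · rw [if_neg hj, Sigma12_apply hmom, sub_add_cancel]
    have h := measurePreserving_eval_two (μ := μ) (ν := ν) hj
    have hm : Measurable fun p : Vec d × 𝒯 × 𝒯 => phiX ev p a * psiX ev p b := by
      have h1 : Measurable fun p : Vec d × 𝒯 × 𝒯 => phiX ev p a :=
        (measurable_ev_apply hev a).comp (by fun_prop : Measurable fun p : Vec d × 𝒯 × 𝒯 =>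
          (p.1, p.2.1))
      have h2 : Measurable fun p : Vec d × 𝒯 × 𝒯 => psiX ev p b :=
        (measurable_ev_apply hev b).comp (by fun_prop : Measurable fun p : Vec d × 𝒯 × 𝒯 =>
          (p.1, p.2.2))
      exact h1.mul h2
    rw [← h.map_eq, integral_map h.aemeasurable hm.aestronglyMeasurable]
    rfl

end Law

/-! ### Sixth moments of blocks -/

section SixthMoment

theorem ennreal_pow_sum_le {ι : Type*} (s : Finset ι) (u : ι → ℝ≥0∞) :
    (∑ i ∈ s, u i) ^ 3 ≤ (s.card : ℝ≥0∞) ^ 2 * ∑ i ∈ s, u i ^ 3 := by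
  have h := ENNReal.rpow_sum_le_const_mul_sum_rpow s u (p := 3) (by norm_num)
  have e : (3 : ℝ) - 1 = (2 : ℕ) := by norm_num
  rw [e] at h
  have e3 : (3 : ℝ) = (3 : ℕ) := by norm_num
  simpa only [e3, ENNReal.rpow_natCast] using h

theorem enorm_sq_euclidean {ι : Type*} [Fintype ι] (y : EuclideanSpace ℝ ι) :
    ‖y‖ₑ ^ 2 = ∑ p, ‖y p‖ₑ ^ 2 := by
  simp only [← ofReal_norm, ← ENNReal.ofReal_pow (norm_nonneg _)]
  rw [← ENNReal.ofReal_sum_of_nonneg fun p _ => by positivity, EuclideanSpace.norm_sq_eq]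

/-- The row `(y_{j1}, …, y_{jd})` of a block. -/
def blockRow {k d : ℕ} (y : Blk k d) (j : Fin k) : Vec d :=
  WithLp.toLp 2 fun a => y (j, a)

/-- Convexity of the cube on the `k` squared row norms. Summing `k` equal moments later gives `k³`,
and the square root gives `k^{3/2}`. -/
theorem enorm_pow_six_block_le {k d : ℕ} (y : Blk k d) :
    ‖y‖ₑ ^ 6 ≤ (k : ℝ≥0∞) ^ 2 * ∑ j, ‖blockRow y j‖ₑ ^ 6 := by
  have h := ennreal_pow_sum_le Finset.univ fun j => ‖blockRow y j‖ₑ ^ 2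
  have e : ‖y‖ₑ ^ 2 = ∑ j, ‖blockRow y j‖ₑ ^ 2 := by
    simp only [enorm_sq_euclidean, Fintype.sum_prod_type]
    rfl
  rw [← e] at h
  simpa only [← pow_mul, Finset.card_univ, Fintype.card_fin] using h

theorem enorm_pow_six_vec_le {d : ℕ} (x : Vec d) :
    ‖x‖ₑ ^ 6 ≤ (d : ℝ≥0∞) ^ 2 * ∑ a, ‖x a‖ₑ ^ 6 := by
  have h := ennreal_pow_sum_le Finset.univ fun a => ‖x a‖ₑ ^ 2
  rw [← enorm_sq_euclidean] at h
  simpa only [← pow_mul, Finset.card_univ, Fintype.card_fin] using h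

theorem measurable_blockRow {k d : ℕ} (j : Fin k) :
    Measurable fun y : Blk k d => blockRow y j := by
  unfold blockRow; fun_prop

theorem rpow_half_cube (k : ℕ) (x : ℝ≥0∞) :
    ((k : ℝ≥0∞) ^ 3 * x) ^ ((1 : ℝ) / 2) = (k : ℝ≥0∞) ^ ((3 : ℝ) / 2) * x ^ ((1 : ℝ) / 2) := by
  rw [ENNReal.mul_rpow_of_nonneg _ _ (by norm_num), ← ENNReal.rpow_natCast, ← ENNReal.rpow_mul]
  norm_num

theorem sixthMoment_blockLaw_le {d k : ℕ} {𝒯 : Type*} [MeasurableSpace 𝒯]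
    {ev : 𝒯 → Vec d → Vec d} (hev : Measurable (Function.uncurry ev)) {μ : Measure (Vec d)}
    [IsProbabilityMeasure μ] {ν : Measure 𝒯} [IsProbabilityMeasure ν] :
    ENNReal.ofReal (1 / 6) * (∫⁻ y, ‖y‖ₑ ^ 6 ∂(blockLaw k ev μ ν)) ^ ((1 : ℝ) / 2) ≤
      (k : ℝ≥0∞) ^ ((3 : ℝ) / 2) * c2 ev μ ν := by
  have hm : Measurable fun p : Vec d × 𝒯 => ‖ev p.2 p.1‖ₑ ^ 6 :=
    ((hev.comp measurable_swap).enorm).pow_const 6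
  have hrow : ∀ j : Fin k, ∫⁻ y, ‖blockRow y j‖ₑ ^ 6 ∂(blockLaw k ev μ ν) =
      ∫⁻ p, ‖phiX ev p‖ₑ ^ 6 ∂(tripleLaw μ ν) := by
    intro j
    rw [blockLaw, lintegral_map ((measurable_blockRow j).enorm.pow_const 6)
      (measurable_blockMap hev)]
    exact lintegral_block_one hm j
  have h : ∫⁻ y, ‖y‖ₑ ^ 6 ∂(blockLaw k ev μ ν) ≤
      (k : ℝ≥0∞) ^ 3 * ∫⁻ p, ‖phiX ev p‖ₑ ^ 6 ∂(tripleLaw μ ν) := by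
    refine (lintegral_mono enorm_pow_six_block_le).trans ?_
    rw [lintegral_const_mul _ (Finset.measurable_fun_sum _ fun j _ =>
      (measurable_blockRow j).enorm.pow_const 6), lintegral_finsetSum _ fun j _ =>
      (measurable_blockRow j).enorm.pow_const 6]
    simp only [hrow, Finset.sum_const, Finset.card_univ, Fintype.card_fin, nsmul_eq_mul]
    rw [← mul_assoc, ← pow_succ]
  rw [c2, mul_left_comm]
  gcongr
  rw [← rpow_half_cube]
  gcongr

theorem sixthMoment_eq_c3 {k d : ℕ} (hk : 0 < k) {Ω : Type*} [MeasurableSpace Ω] (P : Measure Ω)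
    {Z : Ω → Blk k d} : ENNReal.ofReal (1 / 6) * (∫⁻ ω, ‖Z ω‖ₑ ^ 6 ∂P) ^ ((1 : ℝ) / 2) =
      (k : ℝ≥0∞) ^ ((3 : ℝ) / 2) * c3 P Z := by
  have hk0 : (k : ℝ≥0∞) ^ 3 ≠ 0 := pow_ne_zero _ (by exact_mod_cast hk.ne')
  have hkt : (k : ℝ≥0∞) ^ 3 ≠ ∞ := ENNReal.pow_ne_top (ENNReal.natCast_ne_top k)
  have h : ∀ ω, ‖Z ω‖ₑ ^ 6 = (k : ℝ≥0∞) ^ 3 *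
      ENNReal.ofReal ((∑ j, ∑ l, |Z ω (j, l)| ^ 2) ^ 3 / (k : ℝ) ^ 3) := by
    intro ω
    have e : ∑ j, ∑ l, |Z ω (j, l)| ^ 2 = ‖Z ω‖ ^ 2 := by
      rw [EuclideanSpace.norm_sq_eq, Fintype.sum_prod_type]
      simp
    rw [e, ENNReal.ofReal_div_of_pos (by positivity), ← pow_mul,
      ENNReal.ofReal_pow (norm_nonneg _), ofReal_norm, ENNReal.ofReal_pow (by positivity),
      ENNReal.ofReal_natCast, ENNReal.mul_div_cancel hk0 hkt]
  simp only [h]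
  rw [lintegral_const_mul' _ _ hkt, rpow_half_cube, c3]
  ring

end SixthMoment

end Augmentation

namespace Augmentation

/-! ### Gaussian vectors -/

section Gaussian

theorem lintegral_pow_six_gaussianReal_le (m : ℝ) (v : ℝ≥0) :
    ∫⁻ x, ‖x‖ₑ ^ 6 ∂(gaussianReal m v) ≤
      64 * (‖m‖ₑ ^ 6 + (v : ℝ≥0∞) ^ 3 * ∫⁻ x, ‖x‖ₑ ^ 6 ∂(gaussianReal 0 1)) := by
  have h : gaussianReal m v = (gaussianReal 0 1).map fun x => m + Real.sqrt v * x := by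
    have h1 := gaussianReal_map_const_mul (μ := 0) (v := 1) (Real.sqrt v)
    have h2 := gaussianReal_map_const_add (μ := 0) (v := v) m
    have hv : NNReal.mk (Real.sqrt v ^ 2) (sq_nonneg _) * 1 = v := by
      ext; simp
    rw [mul_zero, hv] at h1
    rw [← h1, Measure.map_map (by fun_prop) (by fun_prop), zero_add] at h2
    exact h2.symm
  have hsq : ‖Real.sqrt v‖ₑ ^ 6 = (v : ℝ≥0∞) ^ 3 := by
    rw [← ofReal_norm, Real.norm_of_nonneg (Real.sqrt_nonneg _),
      ← ENNReal.ofReal_pow (Real.sqrt_nonneg _), pow_mul (Real.sqrt v) 2 3,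
      Real.sq_sqrt v.coe_nonneg, ENNReal.ofReal_pow v.coe_nonneg, ENNReal.ofReal_coe_nnreal]
  have hb : ∀ x : ℝ, ‖m + Real.sqrt v * x‖ₑ ^ 6 ≤ 64 * (‖m‖ₑ ^ 6 + v ^ 3 * ‖x‖ₑ ^ 6) := by
    intro x
    -- Bounding a sum by twice the maximum yields the constant `64 = 2⁶`.
    have h1 : ‖m + Real.sqrt v * x‖ₑ ≤ 2 * max ‖m‖ₑ ‖Real.sqrt v * x‖ₑ := by
      rw [two_mul]
      exact (enorm_add_le _ _).trans (add_le_add (le_max_left _ _) (le_max_right _ _))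
    calc ‖m + Real.sqrt v * x‖ₑ ^ 6 ≤ (2 * max ‖m‖ₑ ‖Real.sqrt v * x‖ₑ) ^ 6 := by gcongr
      _ = 64 * max (‖m‖ₑ ^ 6) (‖Real.sqrt v * x‖ₑ ^ 6) := by
        rw [mul_pow, (pow_left_mono 6).map_max]; norm_num
      _ ≤ 64 * (‖m‖ₑ ^ 6 + ‖Real.sqrt v * x‖ₑ ^ 6) := by
        gcongr; exact max_le le_self_add le_add_self
      _ = _ := by rw [enorm_mul, mul_pow, hsq]
  rw [h, lintegral_map (by fun_prop) (by fun_prop)]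
  refine (lintegral_mono hb).trans_eq ?_
  rw [lintegral_const_mul _ (by fun_prop), lintegral_add_left (by fun_prop), lintegral_const,
    lintegral_const_mul _ (by fun_prop), measure_univ, mul_one]

theorem lintegral_pow_six_gaussianReal_ne_top (m : ℝ) (v : ℝ≥0) :
    ∫⁻ x, ‖x‖ₑ ^ 6 ∂(gaussianReal m v) ≠ ∞ := by
  have h := (IsGaussian.memLp_id (gaussianReal m v) 6 (by norm_num)).2
  rw [eLpNorm_lt_top_iff_lintegral_rpow_enorm_lt_top (by norm_num) (by norm_num)] at h
  have e : (6 : ℝ≥0∞).toReal = (6 : ℕ) := by norm_num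
  rw [e] at h
  simpa only [ENNReal.rpow_natCast, id] using h.ne

variable {ι : Type*} [Fintype ι] [DecidableEq ι] (m : EuclideanSpace ℝ ι) (S : Matrix ι ι ℝ)

theorem memLp_multivariateGaussian_apply (p : ι) :
    MemLp (fun z => z p) 2 (multivariateGaussian m S) :=
  (memLp_piLp_iff.1 (IsGaussian.memLp_two_id (μ := multivariateGaussian m S))) p

theorem integral_multivariateGaussian_apply (p : ι) :
    ∫ z, z p ∂(multivariateGaussian m S) = m p := by
  rw [← eval_integral_piLp (f := fun z => z)
    (fun a => (memLp_multivariateGaussian_apply m S a).integrable one_le_two) p,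
    integral_id_multivariateGaussian]

theorem integral_multivariateGaussian_mul {S : Matrix ι ι ℝ} (hS : S.PosSemidef) (p p' : ι) :
    ∫ z, z p * z p' ∂(multivariateGaussian m S) = S p p' + m p * m p' := by
  rw [← covariance_eval_multivariateGaussian (μ := m) hS p p',
    covariance_eq_sub (memLp_multivariateGaussian_apply m S p)
      (memLp_multivariateGaussian_apply m S p'), integral_multivariateGaussian_apply,
    integral_multivariateGaussian_apply, sub_add_cancel]
  rfl

/-- Independent Gaussian vectors on an extension of a given probability space. -/
theorem isIIDGaussian_snd {n k d : ℕ} {Ω : Type*} [MeasurableSpace Ω] (P : Measure Ω)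
    [IsProbabilityMeasure P] (m : Blk k d) {V : Matrix (Fin k × Fin d) (Fin k × Fin d) ℝ}
    (hV : V.PosSemidef) :
    IsIIDGaussian (P.prod (Measure.pi fun _ : Fin n => multivariateGaussian m V)) Prod.snd m V := by
  set Q := P.prod (Measure.pi fun _ : Fin n => multivariateGaussian m V) with hQ
  have hmp : ∀ i, MeasurePreserving (fun ω : Ω × (Fin n → Blk k d) => ω.2 i) Q
      (multivariateGaussian m V) := fun i =>
    (measurePreserving_eval (fun _ => multivariateGaussian m V) i).comp measurePreserving_snd
  refine ⟨measurable_snd, ?_, fun i j => ?_, fun i => ⟨?_⟩, fun i => ?_, fun i => ?_⟩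
  · rw [iIndepFun_iff_map_fun_eq_pi_map fun i => (hmp i).aemeasurable]
    simp only [(hmp _).map_eq]
    exact (measurePreserving_snd (μ := P)
      (ν := Measure.pi fun _ : Fin n => multivariateGaussian m V)).map_eq
  · exact ⟨(hmp i).aemeasurable, (hmp j).aemeasurable, by rw [(hmp i).map_eq, (hmp j).map_eq]⟩
  · rw [(hmp i).map_eq]; infer_instance
  · rw [← integral_map (f := fun z => z) (hmp i).aemeasurable (by fun_prop), (hmp i).map_eq,
      integral_id_multivariateGaussian]
  · ext a b
    have h1 : AEMeasurable (fun z : Blk k d => z a) (Q.map fun ω => ω.2 i) := by fun_prop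
    have h2 : AEMeasurable (fun z : Blk k d => z b) (Q.map fun ω => ω.2 i) := by fun_prop
    rw [← covariance_eval_multivariateGaussian (μ := m) hV a b, ← (hmp i).map_eq,
      covariance_map h1.aestronglyMeasurable h2.aestronglyMeasurable (hmp i).aemeasurable]
    rfl

end Gaussian

/-! ### The Gaussian surrogate law and its sixth moment. -/

section Surrogate

variable {k d : ℕ} {𝒯 : Type*} [MeasurableSpace 𝒯] {δ : ℝ} {ev : 𝒯 → Vec d → Vec d}
  {μ : Measure (Vec d)} {ν : Measure 𝒯}

theorem surrogateMean_apply (p : Fin k × Fin d) :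
    surrogateMean k ev μ ν p = meanAug ev μ ν p.2 := rfl

theorem surrogateCov_apply (p p' : Fin k × Fin d) : surrogateCov k δ ev μ ν p p' =
    if p.1 = p'.1 then (1 - δ) * Sigma11 ev μ ν p.2 p'.2 + δ * Sigma12 ev μ ν p.2 p'.2
      else Sigma12 ev μ ν p.2 p'.2 := by
  obtain ⟨j, a⟩ := p
  obtain ⟨j', b⟩ := p'
  by_cases h : j = j' <;> simp [surrogateCov, h]

/-- The law of the Gaussian vectors. -/
noncomputable def surrogateLaw (k : ℕ) (δ : ℝ) (ev : 𝒯 → Vec d → Vec d) (μ : Measure (Vec d))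
    (ν : Measure 𝒯) : Measure (Blk k d) :=
  multivariateGaussian (surrogateMean k ev μ ν) (surrogateCov k δ ev μ ν)

instance isProbabilityMeasure_surrogateLaw : IsProbabilityMeasure (surrogateLaw k δ ev μ ν) := by
  unfold surrogateLaw; infer_instance

/-- A bound, uniform in `k` and `δ`, on the sixth moments of the Gaussian vectors. -/
noncomputable def sixthMomentBound (ev : 𝒯 → Vec d → Vec d) (μ : Measure (Vec d))
    (ν : Measure 𝒯) : ℝ≥0∞ :=
  (d : ℝ≥0∞) ^ 2 * ∑ a, 64 * (‖meanAug ev μ ν a‖ₑ ^ 6 +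
    ENNReal.ofReal (Sigma11 ev μ ν a a) ^ 3 * ∫⁻ x, ‖x‖ₑ ^ 6 ∂(gaussianReal 0 1))

theorem sixthMomentBound_ne_top : sixthMomentBound ev μ ν ≠ ∞ := by
  refine ENNReal.mul_ne_top (by simp) ((ENNReal.sum_ne_top).2 fun a _ => ?_)
  refine ENNReal.mul_ne_top (by simp) (ENNReal.add_ne_top.2 ⟨by simp, ?_⟩)
  exact ENNReal.mul_ne_top (by simp) (lintegral_pow_six_gaussianReal_ne_top 0 1)

variable [IsProbabilityMeasure μ] [IsProbabilityMeasure ν]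

theorem lintegral_pow_six_surrogateLaw_le (hev : Measurable (Function.uncurry ev))
    (hmom : MemLp (phiX ev) 2 (tripleLaw μ ν)) (hδ : δ ∈ Set.Icc (0 : ℝ) 1) :
    ∫⁻ z, ‖z‖ₑ ^ 6 ∂(surrogateLaw k δ ev μ ν) ≤ (k : ℝ≥0∞) ^ 3 * sixthMomentBound ev μ ν := by
  have hS := posSemidef_surrogateCov k hev hmom hδ
  have hcoord : ∀ p : Fin k × Fin d, ∫⁻ z, ‖z p‖ₑ ^ 6 ∂(surrogateLaw k δ ev μ ν) ≤
      64 * (‖meanAug ev μ ν p.2‖ₑ ^ 6 + ENNReal.ofReal (Sigma11 ev μ ν p.2 p.2) ^ 3 *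
        ∫⁻ x, ‖x‖ₑ ^ 6 ∂(gaussianReal 0 1)) := by
    intro p
    have hmp := measurePreserving_eval_multivariateGaussian (μ := surrogateMean k ev μ ν) hS (i := p)
    -- The diagonal of `Σ₁₁ - Σ₁₂` is nonnegative, so mixing in `Σ₁₂` only lowers the variance. This
    -- makes the bound uniform in `δ`.
    have hv : surrogateCov k δ ev μ ν p p ≤ Sigma11 ev μ ν p.2 p.2 := by
      have h := (posSemidef_Sigma11_sub_Sigma12 hev hmom).diag_nonneg (i := p.2)
      rw [Matrix.sub_apply] at h
      rw [surrogateCov_apply, if_pos rfl]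
      nlinarith [mul_nonneg hδ.1 h]
    rw [surrogateLaw, hmp.lintegral_comp (f := fun x => ‖x‖ₑ ^ 6) (by fun_prop)]
    refine (lintegral_pow_six_gaussianReal_le _ _).trans ?_
    rw [surrogateMean_apply]
    gcongr
    exact ENNReal.ofReal_le_ofReal hv
  have hpt : ∀ z : Blk k d, ‖z‖ₑ ^ 6 ≤
      (k : ℝ≥0∞) ^ 2 * ∑ j, (d : ℝ≥0∞) ^ 2 * ∑ a, ‖z (j, a)‖ₑ ^ 6 := by
    intro z
    refine (enorm_pow_six_block_le z).trans ?_
    gcongr with j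
    exact enorm_pow_six_vec_le (blockRow z j)
  calc _ ≤ ∫⁻ z, (k : ℝ≥0∞) ^ 2 * ∑ j, (d : ℝ≥0∞) ^ 2 * ∑ a, ‖z (j, a)‖ₑ ^ 6
        ∂(surrogateLaw k δ ev μ ν) := lintegral_mono hpt
    _ = (k : ℝ≥0∞) ^ 2 * ∑ j : Fin k, (d : ℝ≥0∞) ^ 2 * ∑ a,
        ∫⁻ z, ‖z (j, a)‖ₑ ^ 6 ∂(surrogateLaw k δ ev μ ν) := by
      rw [lintegral_const_mul _ (by fun_prop), lintegral_finsetSum _ (by fun_prop)]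
      congr 1
      refine Finset.sum_congr rfl fun j _ => ?_
      rw [lintegral_const_mul _ (by fun_prop), lintegral_finsetSum _ (by fun_prop)]
    _ ≤ (k : ℝ≥0∞) ^ 2 * ∑ _j : Fin k, sixthMomentBound ev μ ν := by
      unfold sixthMomentBound
      gcongr with j _ a
      exact hcoord (j, a)
    _ = _ := by
      rw [Finset.sum_const, Finset.card_univ, Fintype.card_fin, nsmul_eq_mul, ← mul_assoc,
        ← pow_succ]

theorem c3_le (hk : 0 < k) (hev : Measurable (Function.uncurry ev))
    (hmom : MemLp (phiX ev) 2 (tripleLaw μ ν)) (hδ : δ ∈ Set.Icc (0 : ℝ) 1) {Ω : Type*}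
    [MeasurableSpace Ω] {P : Measure Ω} {Z : Ω → Blk k d}
    (hZ : MeasurePreserving Z P (surrogateLaw k δ ev μ ν)) :
    c3 P Z ≤ ENNReal.ofReal (1 / 6) * sixthMomentBound ev μ ν ^ ((1 : ℝ) / 2) := by
  have hk0 : (k : ℝ≥0∞) ^ ((3 : ℝ) / 2) ≠ 0 := by
    simp [ENNReal.rpow_eq_zero_iff, hk.ne']
  have hkt : (k : ℝ≥0∞) ^ ((3 : ℝ) / 2) ≠ ∞ :=
    ENNReal.rpow_ne_top_of_nonneg (by norm_num) (ENNReal.natCast_ne_top k)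
  rw [← ENNReal.mul_le_mul_iff_right hk0 hkt, ← sixthMoment_eq_c3 hk, mul_left_comm,
    ← rpow_half_cube, hZ.lintegral_comp (f := fun z => ‖z‖ₑ ^ 6) (by fun_prop)]
  gcongr
  exact lintegral_pow_six_surrogateLaw_le hev hmom hδ

end Surrogate

end Augmentation

namespace Augmentation

set_option maxSynthPendingDepth 3

/-! ### Taylor expansions along the hybrids -/

section HybridTaylor

variable {n k d q : ℕ} {f : (Fin n → Blk k d) → Vec q} {h : Vec q → ℝ}

section Continuity

variable {S : Type*} [TopologicalSpace S] {y z : S → Fin n → Blk k d} {w : S → Blk k d}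

theorem continuous_hybridSlice (hf : Continuous f) (i : Fin n) (hy : Continuous y)
    (hz : Continuous z) (hw : Continuous w) :
    Continuous fun s => hybridSlice f i (y s) (z s) (w s) :=
  hf.comp (continuous_hybrid hy hz hw i)

theorem continuous_fderiv_hybridSlice (hf : ContDiff ℝ 1 f) (i : Fin n) (hy : Continuous y)
    (hz : Continuous z) (v : Blk k d) :
    Continuous fun s => fderiv ℝ (hybridSlice f i (y s) (z s)) 0 v := by
  have := continuous_iteratedFDeriv_hybridSlice (r := 1) (mod_cast hf) i hy hz
    (continuous_const (y := (0 : Blk k d))) fun _ => v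
  simpa only [iteratedFDeriv_one_apply] using this

theorem continuous_fderiv_fderiv_hybridSlice (hf : ContDiff ℝ 2 f) (i : Fin n)
    (hy : Continuous y) (hz : Continuous z) (v v' : Blk k d) :
    Continuous fun s => fderiv ℝ (fderiv ℝ (hybridSlice f i (y s) (z s))) 0 v v' := by
  have := continuous_iteratedFDeriv_hybridSlice (r := 2) (mod_cast hf) i hy hz
    (continuous_const (y := (0 : Blk k d))) ![v, v']
  simpa only [iteratedFDeriv_two_apply, Matrix.cons_val_zero, Matrix.cons_val_one] using this

theorem continuous_gradCoef (hh : IsTimesDiff 3 h) (hf : IsTimesDiff 3 f) (i : Fin n)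
    (hy : Continuous y) (hz : Continuous z) (p : Fin k × Fin d) :
    Continuous fun s => gradCoef h (hybridSlice f i (y s) (z s)) p := by
  have hf2 : ContDiff ℝ 2 f := hf.contDiff
  have hF := continuous_hybridSlice hf2.continuous i hy hz (continuous_const (y := (0 : Blk k d)))
  exact ((isTimesDiff_three_iff.1 hh).2.1.continuous.comp hF).clm_apply
    (continuous_fderiv_hybridSlice (hf2.of_le (by norm_num)) i hy hz _)

theorem continuous_hessCoef (hh : IsTimesDiff 3 h) (hf : IsTimesDiff 3 f) (i : Fin n)
    (hy : Continuous y) (hz : Continuous z) (p : (Fin k × Fin d) × (Fin k × Fin d)) :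
    Continuous fun s => hessCoef h (hybridSlice f i (y s) (z s)) p := by
  have hf2 : ContDiff ℝ 2 f := hf.contDiff
  have hF := continuous_hybridSlice hf2.continuous i hy hz (continuous_const (y := (0 : Blk k d)))
  have h1 := fun v => continuous_fderiv_hybridSlice (hf2.of_le (by norm_num)) i hy hz v
  exact ((((isTimesDiff_three_iff.1 hh).2.2.continuous.comp hF).clm_apply (h1 _)).clm_apply
    (h1 _)).add (((isTimesDiff_three_iff.1 hh).2.1.continuous.comp hF).clm_apply
      (continuous_fderiv_fderiv_hybridSlice hf2 i hy hz _ _))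

theorem continuous_taylorRem (hh : IsTimesDiff 3 h) (hf : IsTimesDiff 3 f) (i : Fin n)
    (hy : Continuous y) (hz : Continuous z) (hw : Continuous w) :
    Continuous fun s => taylorRem h (hybridSlice f i (y s) (z s)) (w s) := by
  have hf2 : ContDiff ℝ 2 f := hf.contDiff
  have hh0 := (isTimesDiff_three_iff.1 hh).1.continuous
  have hF := hh0.comp (continuous_hybridSlice hf2.continuous i hy hz hw)
  have hF0 := hh0.comp
    (continuous_hybridSlice hf2.continuous i hy hz (continuous_const (y := (0 : Blk k d))))
  have hc : ∀ p, Continuous fun s => w s p := fun p => by fun_prop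
  simp only [taylorRem, taylorCoef_apply, quadFeature]
  refine (hF.sub hF0).sub (.add ?_ (.mul continuous_const ?_))
  · exact continuous_finsetSum _ fun p _ => (continuous_gradCoef hh hf i hy hz p).mul (hc p)
  · exact continuous_finsetSum _ fun p _ =>
      (continuous_hessCoef hh hf i hy hz p).mul ((hc p.1).mul (hc p.2))

end Continuity

variable {Ω : Type*} [MeasurableSpace Ω] {P : Measure Ω} {Y Z : Ω → Fin n → Blk k d}

theorem measurable_taylorRem (hh : IsTimesDiff 3 h) (hf : IsTimesDiff 3 f) (i : Fin n)
    (hY : Measurable Y) (hZ : Measurable Z) {x : Ω → Blk k d} (hx : Measurable x) :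
    Measurable fun ω => taylorRem h (hybridSlice f i (Y ω) (Z ω)) (x ω) := by
  have := continuous_taylorRem (S := ((Fin n → Blk k d) × (Fin n → Blk k d)) × Blk k d) hh hf i
    (y := fun s => s.1.1) (z := fun s => s.1.2) (w := fun s => s.2) (by fun_prop) (by fun_prop)
    (by fun_prop)
  exact this.measurable.comp ((hY.prodMk hZ).prodMk hx)

theorem measurable_hessCoef_sum (hh : IsTimesDiff 3 h) (hf : IsTimesDiff 3 f) (i : Fin n)
    (hY : Measurable Y) (hZ : Measurable Z) (C : (Fin k × Fin d) × (Fin k × Fin d) → ℝ) :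
    Measurable fun ω => ∑ p, hessCoef h (hybridSlice f i (Y ω) (Z ω)) p * C p := by
  refine Finset.measurable_fun_sum _ fun p _ => .mul_const ?_ _
  have := continuous_hessCoef (S := (Fin n → Blk k d) × (Fin n → Blk k d)) hh hf i
    (y := fun s => s.1) (z := fun s => s.2) (by fun_prop) (by fun_prop) p
  exact this.measurable.comp (hY.prodMk hZ)

theorem measurable_supDeriv_comp {r : ℕ} (hf : ContDiff ℝ r f) (i : Fin n) (hY : Measurable Y)
    (hZ : Measurable Z) {x : Ω → Blk k d} (hx : Measurable x) :
    Measurable fun ω => supDeriv r f (Y ω) (Z ω) i (x ω) := by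
  have h1 : Measurable fun s : ((Fin n → Blk k d) × (Fin n → Blk k d)) × Blk k d =>
      supDeriv r f s.1.1 s.1.2 i s.2 :=
    measurable_supDeriv hf i (continuous_fst.comp continuous_fst)
      (continuous_snd.comp continuous_fst) continuous_snd
  have h2 := h1.comp ((hY.prodMk hZ).prodMk hx)
  simpa only [Function.comp_def] using h2

/-- The remainder of the Taylor expansion in the `i`-th block. -/
theorem lintegral_taylorRem_le (hh : IsTimesDiff 3 h) (hf : IsTimesDiff 3 f) (i : Fin n)
    (hY : Measurable Y) (hZ : Measurable Z) {x : Ω → Blk k d} (hx : Measurable x)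
    (hα : ∀ r m, normL P m (fun ω => supDeriv r f (Y ω) (Z ω) i (x ω)) ≤ alpha P Y Z f r m) :
    ∫⁻ ω, ‖taylorRem h (hybridSlice f i (Y ω) (Z ω)) (x ω)‖ₑ ∂P ≤
      ENNReal.ofReal (1 / 6) * (∫⁻ ω, ‖x ω‖ₑ ^ 6 ∂P) ^ ((1 : ℝ) / 2) * lambda2 P Y Z f h := by
  have hf2 : ContDiff ℝ 2 f := hf.contDiff
  -- `‖h'‖` along the segment is jointly continuous, so its supremum `H` is measurable and finite
  -- even when `γ³(h) = ∞`.
  let ψ : ((Fin n → Blk k d) × (Fin n → Blk k d)) × Blk k d → ℝ → ℝ := fun s t => ‖fderiv ℝ h (hybridSlice f i s.1.1 s.1.2 (t • s.2))‖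
  have hψ : Continuous (Function.uncurry ψ) := by
    refine ((isTimesDiff_three_iff.1 hh).2.1.continuous.comp
      (continuous_hybridSlice (S := (((Fin n → Blk k d) × (Fin n → Blk k d)) × Blk k d) × ℝ) (y := fun s => s.1.1.1) (z := fun s => s.1.1.2)
        (w := fun s => s.2 • s.1.2) hf2.continuous i ?_ ?_ ?_)).norm <;> fun_prop
  let H : Ω → ℝ≥0∞ := fun ω => unitSup ψ ((Y ω, Z ω), x ω)
  have hs : ∀ ω, ∀ r, ∀ t ∈ Set.Icc (0 : ℝ) 1,
      ENNReal.ofReal (tensorNorm (iteratedFDeriv ℝ r (hybridSlice f i (Y ω) (Z ω)) (t • x ω))) ≤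
        supDeriv r f (Y ω) (Z ω) i (x ω) := fun ω r t ht =>
    ofReal_tensorNorm_le_supDeriv r f i (Y ω) (Z ω) (x ω) ht
  refine (lintegral_third_order_le (P := P) (H := H) (x := fun ω => ‖x ω‖ₑ) (c := ENNReal.ofReal (1 / 6))
    (γ := gamma3 h) (η₂ := eta 2 h) (η₁ := eta 1 h)
    (s₀ := fun ω => supDeriv 0 f (Y ω) (Z ω) i (x ω))
    (s₁ := fun ω => supDeriv 1 f (Y ω) (Z ω) i (x ω))
    (s₂ := fun ω => supDeriv 2 f (Y ω) (Z ω) i (x ω))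
    (s₃ := fun ω => supDeriv 3 f (Y ω) (Z ω) i (x ω))
    (measurable_taylorRem hh hf i hY hZ hx).enorm
    (measurable_supDeriv_comp (hf2.of_le (by norm_num)) i hY hZ hx)
    (measurable_supDeriv_comp (hf2.of_le (by norm_num)) i hY hZ hx)
    (measurable_supDeriv_comp hf2 i hY hZ hx) hx.enorm
    ((measurable_unitSup hψ).comp ((hY.prodMk hZ).prodMk hx)) (fun ω => enorm_ne_top)
    (fun ω => unitSup_ne_top hψ _) ENNReal.ofReal_ne_top (fun ω => ?_) (fun ω => ?_)).trans ?_
  · refine iSup_le fun t => ?_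
    have h0 : ‖hybridSlice f i (Y ω) (Z ω) ((t : ℝ) • x ω)‖ₑ ≤
        supDeriv 0 f (Y ω) (Z ω) i (x ω) := by
      refine le_trans ?_ (hs ω 0 t t.2)
      exact enorm_le_ofReal_tensorNorm _ norm_iteratedFDeriv_zero.symm
    simp only [ψ, ofReal_norm]
    refine (enorm_fderiv_one_le hh _).trans ?_
    gcongr
  · refine enorm_taylorRem_le hh (isTimesDiff_hybridSlice hf i _ _) (x ω)
      (s := fun r => supDeriv r f (Y ω) (Z ω) i (x ω)) (hs ω) fun t ht => ?_
    have := le_unitSup ψ ((Y ω, Z ω), x ω) ht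
    simpa only [ψ, ofReal_norm] using this
  · dsimp only [lambda2]
    gcongr <;> exact hα _ _

/-- The second order terms in the `i`-th block. -/
theorem lintegral_hessCoef_le (hh : IsTimesDiff 3 h) (hf : IsTimesDiff 3 f) (i : Fin n)
    (hY : Measurable Y) (hZ : Measurable Z) (C : (Fin k × Fin d) × (Fin k × Fin d) → ℝ) :
    ∫⁻ ω, ‖∑ p, hessCoef h (hybridSlice f i (Y ω) (Z ω)) p * C p‖ₑ ∂P ≤
      lambda1 P Y Z f h * ENNReal.ofReal (Real.sqrt (∑ p, C p ^ 2)) := by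
  have hf2 : ContDiff ℝ 2 f := hf.contDiff
  let t : ℕ → Ω → ℝ≥0∞ := fun r ω =>
    ENNReal.ofReal (tensorNorm (iteratedFDeriv ℝ r (hybridSlice f i (Y ω) (Z ω)) 0))
  have ht : ∀ r : ℕ, ContDiff ℝ r f → Measurable (t r) := fun r hr => by
    have := continuous_tensorNorm_hybridSlice (S := (Fin n → Blk k d) × (Fin n → Blk k d)) hr i
      (y := fun s => s.1) (z := fun s => s.2) (w := fun _ => 0) (by fun_prop) (by fun_prop)
      (by fun_prop)
    exact (this.measurable.comp (hY.prodMk hZ)).ennreal_ofReal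
  have hα : ∀ r m, normL P m (t r) ≤ alpha P Y Z f r m := fun r m => by
    -- The expansion point `0` lies on the segment to any block, so either entry of the maximum in
    -- `alpha` would serve.
    refine le_trans (normL_mono fun ω => ?_) (le_iSup_of_le i (le_max_left _ _))
    have := ofReal_tensorNorm_le_supDeriv r f i (Y ω) (Z ω) (Y ω i) (t := 0) (by simp)
    simpa only [zero_smul] using this
  have hm0 := ht 0 (hf2.of_le (by norm_num))
  have hm1 := ht 1 (hf2.of_le (by norm_num))
  have hm2 := ht 2 hf2
  refine (lintegral_mono fun ω => enorm_hessCoef_mul_le hh (hybridSlice f i (Y ω) (Z ω)) C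
    (t₀ := t 0 ω) (t₁ := t 1 ω) (t₂ := t 2 ω) rfl rfl rfl).trans ?_
  rw [lintegral_mul_const _ (by fun_prop)]
  gcongr
  refine (lintegral_second_order_le hm0 hm1 hm2 _ _ _).trans ?_
  dsimp only [lambda1]
  gcongr <;> exact hα _ _

/-- Neighbouring hybrids coincide: filling slot `i` with `y i` gives the same configuration as
filling slot `i + 1` with `z (i + 1)`. Both belong to the one-parameter family `M`. -/
theorem sub_eq_sum_hybrid {β : Type*} [AddCommGroup β] (g : (Fin n → Blk k d) → β)
    (y z : Fin n → Blk k d) :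
    g y - g z = ∑ i, (g (hybrid y z i (y i)) - g (hybrid y z i (z i))) := by
  let M : ℕ → Fin n → Blk k d := fun m j => if (j : ℕ) < m then y j else z j
  have h1 : ∀ i : Fin n, hybrid y z i (y i) = M (i + 1) := fun i => by
    funext j
    rcases lt_trichotomy j i with hj | rfl | hj
    · simp [hybrid, M, hj, Nat.lt_succ_of_lt hj]
    · simp [hybrid, M]
    · have : ¬ (j : ℕ) < i + 1 := by omega
      simp [hybrid, M, hj.not_gt, hj.ne', this]
  have h2 : ∀ i : Fin n, hybrid y z i (z i) = M i := fun i => by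
    funext j
    rcases lt_trichotomy j i with hj | rfl | hj
    · simp [hybrid, M, hj]
    · simp [hybrid, M]
    · simp [hybrid, M, hj.not_gt, hj.ne']
  have e1 : M n = y := by funext j; simp [M]
  have e0 : M 0 = z := by funext j; simp [M]
  simp only [h1, h2]
  rw [Fin.sum_univ_eq_sum_range (fun i => g (M (i + 1)) - g (M i)), Finset.sum_range_sub
    (fun i => g (M i)), e1, e0]

/-- The slice holds `y` before `i`, `z` after `i`, and a free argument at `i`, so its Taylor
coefficients see neither exchanged block. -/
theorem isHybridPredictable_taylorCoef (h : Vec q → ℝ) (f : (Fin n → Blk k d) → Vec q) :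
    IsHybridPredictable fun i y z => taylorCoef h (hybridSlice f i y z) := by
  intro i y y' z z' hy hz
  have : hybridSlice f i y z = hybridSlice f i y' z' := by
    funext w
    refine congrArg f (funext fun j => ?_)
    rcases lt_trichotomy j i with hj | rfl | hj
    · simp [hybrid, hj, hy j hj]
    · simp [hybrid]
    · simp [hybrid, hj.not_gt, hj.ne', hz j hj]
  simp only [this]

/-- The Lindeberg decomposition: Taylor polynomials with corrected second moments form a
`hybridSum`. -/
theorem sub_eq_hybridSum_add (h : Vec q → ℝ) (f : (Fin n → Blk k d) → Vec q)
    (c : (Fin k × Fin d → ℝ) × ((Fin k × Fin d) × (Fin k × Fin d) → ℝ))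
    (C : (Fin k × Fin d) × (Fin k × Fin d) → ℝ) (y z : Fin n → Blk k d) :
    h (f y) - h (f z) =
      hybridSum (fun u => quadFeature u - c) (fun u => quadFeature u + (0, C) - c)
        (fun i y z => taylorCoef h (hybridSlice f i y z)) (y, z) +
      ∑ i, (taylorRem h (hybridSlice f i y z) (y i) - taylorRem h (hybridSlice f i y z) (z i) +
        1 / 2 * ∑ p, hessCoef h (hybridSlice f i y z) p * C p) := by
  rw [sub_eq_sum_hybrid (fun v => h (f v)) y z, hybridSum, ← Finset.sum_add_distrib]
  refine Finset.sum_congr rfl fun i _ => ?_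
  have e : (quadFeature (y i) - c) - (quadFeature (z i) + (0, C) - c) =
      quadFeature (y i) - quadFeature (z i) - (0, C) := by abel
  have eC : taylorCoef h (hybridSlice f i y z) (0, C) =
      1 / 2 * ∑ p, hessCoef h (hybridSlice f i y z) p * C p := by
    simp [taylorCoef_apply]
  simp only [e, map_sub, eC, taylorRem]
  simp only [hybridSlice]
  ring

end HybridTaylor

end Augmentation

namespace Augmentation

/-! ### The comparison of expectations -/

section Comparison

/-! ### First and second moments as the mean of a feature vector. -/

section QuadFeature

variable {ι : Type*} [Fintype ι] {ρ : Measure (EuclideanSpace ℝ ι)}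

theorem integrable_quadFeature [IsFiniteMeasure ρ] (hρ : ∀ p, MemLp (fun x => x p) 2 ρ) :
    Integrable (fun x : EuclideanSpace ℝ ι => quadFeature x) ρ :=
  (Integrable.of_eval fun p => (hρ p).integrable one_le_two).prodMk
    (Integrable.of_eval fun p => (hρ p.1).integrable_mul (hρ p.2))

theorem integral_quadFeature [IsFiniteMeasure ρ] (hρ : ∀ p, MemLp (fun x => x p) 2 ρ) :
    ∫ x, quadFeature x ∂ρ = (fun p => ∫ x, x p ∂ρ, fun p => ∫ x, x p.1 * x p.2 ∂ρ) := by
  have h1 : ∀ p, Integrable (fun x : EuclideanSpace ℝ ι => x p) ρ := fun p =>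
    (hρ p).integrable one_le_two
  have h2 : ∀ p : ι × ι, Integrable (fun x : EuclideanSpace ℝ ι => x p.1 * x p.2) ρ := fun p =>
    (hρ p.1).integrable_mul (hρ p.2)
  unfold quadFeature
  rw [integral_pair (Integrable.of_eval h1) (Integrable.of_eval h2)]
  ext p
  · exact eval_integral h1 p
  · exact eval_integral h2 p

end QuadFeature

variable {n k d q : ℕ} {f : (Fin n → Blk k d) → Vec q} {h : Vec q → ℝ}
  {Ω : Type*} [MeasurableSpace Ω] {P : Measure Ω} {Y Z : Ω → Fin n → Blk k d}

/-- If the blocks have the same first moments, and second moments that differ by `C`, then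
exchanging them costs the remainders of order three and a term of order two. -/
theorem ofReal_abs_integral_sub_le [IsProbabilityMeasure P]
    {B G : Measure (Blk k d)} [IsProbabilityMeasure B] [IsProbabilityMeasure G]
    (hY : Measurable Y) (hZ : Measurable Z)
    (hlaw : P.map (fun ω => (Y ω, Z ω)) =
      (Measure.pi fun _ => B).prod (Measure.pi fun _ => G))
    (hB : ∀ p, MemLp (fun x => x p) 2 B) (hG : ∀ p, MemLp (fun x => x p) 2 G)
    (C : (Fin k × Fin d) × (Fin k × Fin d) → ℝ) (hmean : ∀ p, ∫ x, x p ∂B = ∫ x, x p ∂G)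
    (hC : ∀ p : (Fin k × Fin d) × (Fin k × Fin d),
      ∫ x, x p.1 * x p.2 ∂B = ∫ x, x p.1 * x p.2 ∂G + C p)
    (hh : IsTimesDiff 3 h) (hf : IsTimesDiff 3 f) (hiY : Integrable (fun ω => h (f (Y ω))) P)
    (hiZ : Integrable (fun ω => h (f (Z ω))) P) :
    ENNReal.ofReal |(∫ ω, h (f (Y ω)) ∂P) - ∫ ω, h (f (Z ω)) ∂P| ≤
      ∑ i, (∫⁻ ω, ‖taylorRem h (hybridSlice f i (Y ω) (Z ω)) (Y ω i)‖ₑ ∂P +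
        ∫⁻ ω, ‖taylorRem h (hybridSlice f i (Y ω) (Z ω)) (Z ω i)‖ₑ ∂P +
        ENNReal.ofReal (1 / 2) *
          ∫⁻ ω, ‖∑ p, hessCoef h (hybridSlice f i (Y ω) (Z ω)) p * C p‖ₑ ∂P) := by
  have hYi : ∀ i, Measurable fun ω => Y ω i := fun i => (measurable_pi_apply i).comp hY
  have hZi : ∀ i, Measurable fun ω => Z ω i := fun i => (measurable_pi_apply i).comp hZ
  have mR1 := fun i => measurable_taylorRem hh hf i hY hZ (hYi i)
  have mR2 := fun i => measurable_taylorRem hh hf i hY hZ (hZi i)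
  have mH := fun i => measurable_hessCoef_sum hh hf i hY hZ C
  set D : Ω → ℝ := fun ω => ∑ i, (taylorRem h (hybridSlice f i (Y ω) (Z ω)) (Y ω i) -
    taylorRem h (hybridSlice f i (Y ω) (Z ω)) (Z ω i) +
      1 / 2 * ∑ p, hessCoef h (hybridSlice f i (Y ω) (Z ω)) p * C p) with hD
  have mD : Measurable D := Finset.measurable_fun_sum _ fun i _ =>
    ((mR1 i).sub (mR2 i)).add ((mH i).const_mul _)
  set RHS := ∑ i, (∫⁻ ω, ‖taylorRem h (hybridSlice f i (Y ω) (Z ω)) (Y ω i)‖ₑ ∂P +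
        ∫⁻ ω, ‖taylorRem h (hybridSlice f i (Y ω) (Z ω)) (Z ω i)‖ₑ ∂P +
        ENNReal.ofReal (1 / 2) *
          ∫⁻ ω, ‖∑ p, hessCoef h (hybridSlice f i (Y ω) (Z ω)) p * C p‖ₑ ∂P) with hRHS
  have hDle : ∫⁻ ω, ‖D ω‖ₑ ∂P ≤ RHS := by
    calc ∫⁻ ω, ‖D ω‖ₑ ∂P
        ≤ ∫⁻ ω, ∑ i, (‖taylorRem h (hybridSlice f i (Y ω) (Z ω)) (Y ω i)‖ₑ +
            ‖taylorRem h (hybridSlice f i (Y ω) (Z ω)) (Z ω i)‖ₑ +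
            ENNReal.ofReal (1 / 2) *
              ‖∑ p, hessCoef h (hybridSlice f i (Y ω) (Z ω)) p * C p‖ₑ) ∂P := by
          refine lintegral_mono fun ω => (enorm_sum_le _ _).trans (Finset.sum_le_sum fun i _ => ?_)
          refine (enorm_add_le _ _).trans (add_le_add enorm_sub_le (le_of_eq ?_))
          rw [enorm_mul, ← ofReal_norm (1 / 2 : ℝ), Real.norm_of_nonneg (by norm_num)]
      _ = RHS := by
          refine (lintegral_finsetSum _ fun i _ =>
            ((mR1 i).enorm.add (mR2 i).enorm).add ((mH i).enorm.const_mul _)).trans ?_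
          refine Finset.sum_congr rfl fun i _ => ?_
          refine (lintegral_add_left ((mR1 i).enorm.add (mR2 i).enorm) _).trans ?_
          rw [lintegral_const_mul _ (mH i).enorm]
          congr 1
          exact lintegral_add_left (mR1 i).enorm _
  -- An infinite bound is trivial; a finite one makes `D` integrable, and then `M`, the total
  -- difference minus `D`, is integrable too.
  rcases eq_or_ne RHS ∞ with htop | htop
  · rw [htop]; exact le_top
  have hDi : Integrable D P :=
    ⟨mD.aestronglyMeasurable, hDle.trans_lt (lt_top_iff_ne_top.2 htop)⟩
  -- Both increments are centred at `c`: matching means and the shift of the Gaussian second moments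
  -- by `C` give the two feature vectors the same expectation.
  set c := ∫ x, quadFeature x ∂B with hc
  set M := hybridSum (fun u => quadFeature u - c) (fun u => quadFeature u + (0, C) - c)
    (fun i y z => taylorCoef h (hybridSlice f i y z)) with hM
  have e : ∀ ω, h (f (Y ω)) - h (f (Z ω)) = M (Y ω, Z ω) + D ω := fun ω =>
    sub_eq_hybridSum_add h f c C (Y ω) (Z ω)
  have mYZ : Measurable fun ω => (Y ω, Z ω) := hY.prodMk hZ
  have hMi : Integrable (fun ω => M (Y ω, Z ω)) P := by
    refine ((hiY.sub hiZ).sub hDi).congr (.of_forall fun ω => ?_)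
    simp only [Pi.sub_apply, e ω, add_sub_cancel_right]
  have hM' : M = fun s => h (f s.1) - h (f s.2) - ∑ i,
      (taylorRem h (hybridSlice f i s.1 s.2) (s.1 i) - taylorRem h (hybridSlice f i s.1 s.2) (s.2 i)
        + 1 / 2 * ∑ p, hessCoef h (hybridSlice f i s.1 s.2) p * C p) := by
    funext s
    rw [sub_eq_hybridSum_add h f c C s.1 s.2, add_sub_cancel_right]
  have mM : Measurable M := by
    have h1 : Measurable fun v : Fin n → Blk k d => h (f v) :=
      ((isTimesDiff_three_iff.1 hh).1.continuous.comp
        (isTimesDiff_three_iff.1 hf).1.continuous).measurable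
    have m1 : ∀ i, Measurable fun s : (Fin n → Blk k d) × (Fin n → Blk k d) => s.1 i :=
      fun i => by fun_prop
    have m2 : ∀ i, Measurable fun s : (Fin n → Blk k d) × (Fin n → Blk k d) => s.2 i :=
      fun i => by fun_prop
    rw [hM']
    exact ((h1.comp measurable_fst).sub (h1.comp measurable_snd)).sub
      (Finset.measurable_fun_sum _ fun i _ =>
        ((measurable_taylorRem hh hf i measurable_fst measurable_snd (m1 i)).sub
          (measurable_taylorRem hh hf i measurable_fst measurable_snd (m2 i))).add
        ((measurable_hessCoef_sum hh hf i measurable_fst measurable_snd C).const_mul _))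
  have iB := integrable_quadFeature hB
  have iG := (integrable_quadFeature hG).add (integrable_const ((0, C) :
    (Fin k × Fin d → ℝ) × ((Fin k × Fin d) × (Fin k × Fin d) → ℝ)))
  have hcG : ∫ x, quadFeature x ∂G + (0, C) = c := by
    rw [hc, integral_quadFeature hB, integral_quadFeature hG]
    ext p
    · simp [hmean]
    · simp [hC]
  have hM0 : ∫ ω, M (Y ω, Z ω) ∂P = 0 := by
    rw [← integral_map (f := M) mYZ.aemeasurable mM.aestronglyMeasurable, hlaw]
    refine integral_hybridSum_eq_zero (iB.sub (integrable_const c)) (iG.sub (integrable_const c))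
      ?_ ?_ _ (isHybridPredictable_taylorCoef h f) ?_
    · refine (integral_sub' iB (integrable_const c)).trans ?_
      simp [hc]
    · refine (integral_sub' iG (integrable_const c)).trans ?_
      rw [integral_add' (integrable_quadFeature hG) (integrable_const _)]
      simp [hcG]
    · rw [← hlaw]
      exact (integrable_map_measure mM.aestronglyMeasurable mYZ.aemeasurable).2 hMi
  have hΔ : (∫ ω, h (f (Y ω)) ∂P) - ∫ ω, h (f (Z ω)) ∂P = ∫ ω, D ω ∂P := by
    rw [← integral_sub hiY hiZ, integral_congr_ae (.of_forall e), integral_add hMi hDi, hM0,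
      zero_add]
  rw [hΔ, ← Real.norm_eq_abs, ofReal_norm]
  exact (enorm_integral_le_lintegral_enorm _).trans hDle

end Comparison

/-! ### The covariance gap and the constant `c₁`. -/

section SecondMoments

variable {k d : ℕ} {𝒯 : Type*} [MeasurableSpace 𝒯] {δ : ℝ} {ev : 𝒯 → Vec d → Vec d}
  {μ : Measure (Vec d)} {ν : Measure 𝒯}

/-- The difference of the covariance matrices of an augmented block and its surrogate. -/
noncomputable def covGap (k : ℕ) (δ : ℝ) (ev : 𝒯 → Vec d → Vec d) (μ : Measure (Vec d))
    (ν : Measure 𝒯) (p : (Fin k × Fin d) × (Fin k × Fin d)) : ℝ :=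
  if p.1.1 = p.2.1 then δ * (Sigma11 ev μ ν - Sigma12 ev μ ν) p.1.2 p.2.2 else 0

/-- Only the `k` diagonal positions contribute, each with the same squared norm, whence `√k` rather
than `k`. -/
theorem sqrt_sum_covGap_sq (hδ : 0 ≤ δ) : Real.sqrt (∑ p, covGap k δ ev μ ν p ^ 2) =
    δ * Real.sqrt k * matrixNorm (Sigma11 ev μ ν - Sigma12 ev μ ν) := by
  have e : ∑ p, covGap k δ ev μ ν p ^ 2 =
      δ ^ 2 * k * ∑ a, ∑ b, (Sigma11 ev μ ν - Sigma12 ev μ ν) a b ^ 2 := by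
    have h1 : ∀ (i : Fin k) (a : Fin d), ∑ j : Fin k, ∑ b, covGap k δ ev μ ν ((i, a), (j, b)) ^ 2 =
        δ ^ 2 * ∑ b, (Sigma11 ev μ ν - Sigma12 ev μ ν) a b ^ 2 := by
      intro i a
      rw [Finset.sum_eq_single i]
      · simp [covGap, mul_pow, Finset.mul_sum]
      · intro j _ hj
        simp [covGap, hj.symm]
      · simp
    simp only [Fintype.sum_prod_type, h1, ← Finset.mul_sum, Finset.sum_const, Finset.card_univ,
      Fintype.card_fin, nsmul_eq_mul]
    ring
  rw [e, Real.sqrt_mul (by positivity), Real.sqrt_mul (by positivity), Real.sqrt_sq hδ, matrixNorm]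

variable [IsProbabilityMeasure μ] [IsProbabilityMeasure ν]

theorem integral_blockLaw_mul_eq (hev : Measurable (Function.uncurry ev))
    (hmom : MemLp (phiX ev) 2 (tripleLaw μ ν)) (hδ : δ ∈ Set.Icc (0 : ℝ) 1)
    (p : (Fin k × Fin d) × (Fin k × Fin d)) :
    ∫ y, y p.1 * y p.2 ∂(blockLaw k ev μ ν) =
      ∫ z, z p.1 * z p.2 ∂(surrogateLaw k δ ev μ ν) + covGap k δ ev μ ν p := by
  rw [integral_blockLaw_mul hev hmom, surrogateLaw,
    integral_multivariateGaussian_mul _ (posSemidef_surrogateCov k hev hmom hδ),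
    surrogateCov_apply, surrogateMean_apply, surrogateMean_apply, covGap]
  split_ifs <;> simp only [Matrix.sub_apply] <;> ring

theorem ofReal_sqrt_sum_covGap_sq (hev : Measurable (Function.uncurry ev))
    (hmom : MemLp (phiX ev) 2 (tripleLaw μ ν)) (hδ : 0 ≤ δ) :
    ENNReal.ofReal (1 / 2) * ENNReal.ofReal (Real.sqrt (∑ p, covGap k δ ev μ ν p ^ 2)) =
      (k : ℝ≥0∞) ^ ((1 : ℝ) / 2) * ENNReal.ofReal δ * c1 ev μ ν := by
  have hN : 0 ≤ matrixNorm (Sigma11 ev μ ν - Sigma12 ev μ ν) := Real.sqrt_nonneg _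
  have hk : (k : ℝ≥0∞) ^ ((1 : ℝ) / 2) = ENNReal.ofReal (Real.sqrt k) := by
    rw [Real.sqrt_eq_rpow, ← ENNReal.ofReal_rpow_of_nonneg (Nat.cast_nonneg k) (by norm_num),
      ENNReal.ofReal_natCast]
  rw [sqrt_sum_covGap_sq hδ, c1, expCondVar_phiX hev hmom, hk, ← ENNReal.ofReal_mul (by norm_num),
    ← ENNReal.ofReal_mul (Real.sqrt_nonneg _), ← ENNReal.ofReal_mul (by positivity)]
  congr 1
  ring

end SecondMoments

end Augmentation

/-! ### Assembly of the main theorem. -/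

theorem mainTheorem1 {d : ℕ} {𝒯 : Type v} [MeasurableSpace 𝒯]
    (ev : 𝒯 → Vec d → Vec d) (hev : Measurable (Function.uncurry ev))
    (μ : Measure (Vec d)) [IsProbabilityMeasure μ] (ν : Measure 𝒯) [IsProbabilityMeasure ν]
    (hmom : MemLp (phiX ev) 2 (tripleLaw μ ν)) :
    -- `C` bounds `c₃`; it depends only on `ev`, `μ`, `ν`, and not on `n`, `k`, `δ`
    ∃ C : ℝ≥0, ∀ (n k : ℕ) (hn : 0 < n) (_ : 0 < k)
      (Ω : Type u) [MeasurableSpace Ω] (P : Measure Ω) [IsProbabilityMeasure P]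
      (X : Fin n → Ω → Vec d) (φ : Fin n → Fin k → Ω → 𝒯) (_ : IsSample P μ ν X φ)
      (δ : ℝ) (_ : δ ∈ Set.Icc (0 : ℝ) 1),
      -- an extension `π : (Ω', P') → (Ω, P)` of the probability space carries the vectors `Z`
      ∃ (Ω' : Type u) (_ : MeasurableSpace Ω') (P' : Measure Ω') (_ : IsProbabilityMeasure P')
        (π : Ω' → Ω) (_ : MeasurePreserving π P' P) (Z : Ω' → Fin n → Blk k d),
        IsIIDGaussian P' Z (surrogateMean k ev μ ν) (surrogateCov k δ ev μ ν) ∧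
        IndepFun π Z P' ∧
        c3 P' (fun ω => Z ω ⟨0, hn⟩) ≤ C ∧
        ∀ (q : ℕ) (f : (Fin n → Blk k d) → Vec q) (h : Vec q → ℝ),
          IsTimesDiff 3 f → IsTimesDiff 3 h →
          -- the two expectations in the claim exist
          Integrable (fun ω => h (f (augmentedData ev φ X ω))) P →
          Integrable (fun ω => h (f (Z ω))) P' →
          ENNReal.ofReal
              |(∫ ω, h (f (augmentedData ev φ X ω)) ∂P) - ∫ ω, h (f (Z ω)) ∂P'| ≤
            n * (k : ℝ≥0∞) ^ ((1 : ℝ) / 2) * lambda1 P' (augmentedData ev φ X ∘ π) Z f h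
                * ENNReal.ofReal δ * c1 ev μ ν
              + n * (k : ℝ≥0∞) ^ ((3 : ℝ) / 2) * lambda2 P' (augmentedData ev φ X ∘ π) Z f h
                * (c2 ev μ ν + c3 P' (fun ω => Z ω ⟨0, hn⟩)) := by
  have hB : ENNReal.ofReal (1 / 6) * sixthMomentBound ev μ ν ^ ((1 : ℝ) / 2) ≠ ∞ :=
    ENNReal.mul_ne_top ENNReal.ofReal_ne_top
      (ENNReal.rpow_ne_top_of_nonneg (by norm_num) sixthMomentBound_ne_top)
  -- The constant involves only `d`, the mean, the diagonal of `Σ₁₁` and a standard Gaussian moment;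
  -- it is finite even if `c₂` is not.
  refine ⟨(ENNReal.ofReal (1 / 6) * sixthMomentBound ev μ ν ^ ((1 : ℝ) / 2)).toNNReal, ?_⟩
  intro n k hn hk Ω _ P _ X φ hs δ hδ
  have hprob := isProbabilityMeasure_blockLaw (k := k) (μ := μ) (ν := ν) hev
  set G := surrogateLaw k δ ev μ ν with hG
  set Q := P.prod (Measure.pi fun _ : Fin n => G) with hQ
  have hmp : ∀ i, MeasurePreserving (fun ω : Ω × (Fin n → Blk k d) => ω.2 i) Q G := fun i =>
    (measurePreserving_eval (fun _ => G) i).comp measurePreserving_snd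
  -- The extension is the product with `n` copies of the surrogate law, so the Gaussian coordinates
  -- are independent of everything on `Ω`.
  refine ⟨Ω × (Fin n → Blk k d), inferInstance, Q, inferInstance, Prod.fst,
    measurePreserving_fst, Prod.snd,
    isIIDGaussian_snd P _ (posSemidef_surrogateCov k hev hmom hδ),
    indepFun_prod measurable_id measurable_id, ?_, ?_⟩
  · rw [ENNReal.coe_toNNReal hB]
    exact c3_le hk hev hmom hδ (hmp ⟨0, hn⟩)
  intro q f h hf hh hiY hiZ
  set Y := augmentedData ev φ X ∘ (Prod.fst : Ω × (Fin n → Blk k d) → Ω) with hY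
  have hYm : Measurable (augmentedData ev φ X) := measurable_augmentedData hev hs
  have hmY : MeasurePreserving Y Q (Measure.pi fun _ => blockLaw k ev μ ν) :=
    MeasurePreserving.comp ⟨hYm, map_augmentedData hev hs⟩ measurePreserving_fst
  have hlaw : Q.map (fun ω => (Y ω, ω.2)) =
      (Measure.pi fun _ => blockLaw k ev μ ν).prod (Measure.pi fun _ => G) := by
    have := (MeasurePreserving.mk hYm (map_augmentedData (k := k) hev hs)).prod
      (MeasurePreserving.id (Measure.pi fun _ : Fin n => G))
    exact this.map_eq
  have hYi : ∀ i, MeasurePreserving (fun ω => Y ω i) Q (blockLaw k ev μ ν) := fun i =>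
    (measurePreserving_eval (fun _ => blockLaw k ev μ ν) i).comp hmY
  have hint : ∫ ω, h (f (augmentedData ev φ X ω)) ∂P = ∫ ω, h (f (Y ω)) ∂Q := by
    refine (?_ : ∫ ω, h (f (Y ω)) ∂Q = _).symm
    rw [hQ, hY]
    refine (integral_fun_fst fun ω => h (f (augmentedData ev φ X ω))).trans ?_
    simp
  have hiY' : Integrable (fun ω => h (f (Y ω))) Q := hiY.comp_fst _
  have hc3 : ENNReal.ofReal (1 / 6) * (∫⁻ z, ‖z‖ₑ ^ 6 ∂G) ^ ((1 : ℝ) / 2) =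
      (k : ℝ≥0∞) ^ ((3 : ℝ) / 2) * c3 Q (fun ω => ω.2 ⟨0, hn⟩) := by
    rw [← sixthMoment_eq_c3 hk, (hmp ⟨0, hn⟩).lintegral_comp (f := fun z => ‖z‖ₑ ^ 6)
      (by fun_prop)]
  rw [hint]
  refine (ofReal_abs_integral_sub_le hmY.measurable measurable_snd hlaw
    (memLp_blockLaw_apply hev hmom) (memLp_multivariateGaussian_apply _ _) (covGap k δ ev μ ν)
    (fun p => ?_) (integral_blockLaw_mul_eq hev hmom hδ) hh hf hiY' hiZ).trans ?_
  · rw [integral_blockLaw_apply hev hmom, hG, surrogateLaw, integral_multivariateGaussian_apply,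
      surrogateMean_apply]
  -- The bound for one exchange does not depend on `i`, because `alpha` is a maximum over blocks and
  -- the blocks have equal laws; summation gives the factor `n`.
  calc _ ≤ ∑ _i : Fin n, ((k : ℝ≥0∞) ^ ((3 : ℝ) / 2) * c2 ev μ ν * lambda2 Q Y Prod.snd f h +
        (k : ℝ≥0∞) ^ ((3 : ℝ) / 2) * c3 Q (fun ω => ω.2 ⟨0, hn⟩) * lambda2 Q Y Prod.snd f h +
        lambda1 Q Y Prod.snd f h *
          ((k : ℝ≥0∞) ^ ((1 : ℝ) / 2) * ENNReal.ofReal δ * c1 ev μ ν)) := by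
        refine Finset.sum_le_sum fun i _ => add_le_add (add_le_add ?_ ?_) ?_
        · refine (lintegral_taylorRem_le hh hf i hmY.measurable measurable_snd
            (hYi i).measurable fun r m => le_iSup_of_le i (le_max_left _ _)).trans ?_
          rw [(hYi i).lintegral_comp (f := fun z => ‖z‖ₑ ^ 6) (by fun_prop)]
          exact mul_le_mul_left (sixthMoment_blockLaw_le hev) _
        · refine (lintegral_taylorRem_le hh hf i hmY.measurable measurable_snd
            (hmp i).measurable fun r m => le_iSup_of_le i (le_max_right _ _)).trans ?_
          rw [(hmp i).lintegral_comp (f := fun z => ‖z‖ₑ ^ 6) (by fun_prop), hc3]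
        · rw [← ofReal_sqrt_sum_covGap_sq hev hmom hδ.1, mul_left_comm]
          gcongr
          exact lintegral_hessCoef_le hh hf i hmY.measurable measurable_snd _
    _ = _ := by
        rw [Finset.sum_const, Finset.card_univ, Fintype.card_fin, nsmul_eq_mul]
        ring
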